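/- Let $d\ge 1$, let $1<p,q<\infty$ with $\frac1p+\frac1q=1$, and put $|x|=\max_{1\le i\le d}|x_i|$ for $x=(x_1,\dots,x_d)\in\mathbb Z^d$ (the word length for the generating set $\{-1,0,1\}^d$). For $\omega:\mathbb Z^d\to(0,\infty)$ let $l^p_\omega(\mathbb Z^d)=\{f:\mathbb Z^d\to\mathbb C : f\omega\in l^p(\mathbb Z^d)\}$ with norm $\|f\|=\|f\omega\|_p$. It is called a Banach algebra if, for all $f,g$ in it, the convolution $(f*g)(x)=\sum_y f(y)g(x-y)$ converges absolutely at every $x$ and belongs to $l^p_\omega(\mathbb Z^d)$, the product $*$ is associative, and $\|f*g\|\le K\|f\|\,\|g\|$ with a constant $K$. A Banach algebra $A$ is weakly amenable if every bounded derivation $D:A\to A^*$ is inner. Consider the weights $$\omega_\beta(x)=(1+|x|)^\beta,\qquad \sigma_{\alpha,C}(x)=e^{C|x|^\alpha},\qquad \rho_{\gamma,C}(x)=e^{C|x|/(\ln(1+|x|))^\gamma}\quad(\rho_{\gamma,C}(0)=1).$$ 1. For every $\beta\ge 0$: $l^p_{\omega_\beta}(\mathbb Z^d)$ is a Banach algebra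 if and only if $1/\omega_\beta\in l^q(\mathbb Z^d)$, and if and only if $\beta>d/q$. 2. If $1<p<2$ and $d/q<\beta<1/2$, then $l^p_{\omega_\beta}(\mathbb Z^d)$ is weakly amenable. 3. If $p>2$ and $\beta>d/q$, then $l^p_{\omega_\beta}(\mathbb Z^d)$ is not weakly amenable. 4. For all $0<\alpha<1$ and $C>0$, $l^p_{\sigma_{\alpha,C}}(\mathbb Z^d)$ is a Banach algebra; and for all $0<\alpha\le 1$ and $C>0$, if $l^p_{\sigma_{\alpha,C}}(\mathbb Z^d)$ is a Banach algebra, then it is not weakly amenable. 5. For all $\gamma>0$ and $C>0$, $l^p_{\rho_{\gamma,C}}(\mathbb Z^d)$ is a Banach algebra and it is not weakly amenable. -/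

import Mathlib

open scoped Pointwise

/-- A strictly positive function on `G`, used as a weight. -/
structure PosWeight (G : Type*) where
  toFun : G → ℝ
  pos : ∀ x, 0 < toFun x

/-- The linear space of all `f : G → ℂ` such that `ω f ∈ l^p(G)`. -/
def weightedLpSubmodule {G : Type*} (ω : PosWeight G) (p : ℝ) : Submodule ℂ (G → ℂ) where
  carrier := {f | Memℓp (fun x => (ω.toFun x : ℂ) * f x) (ENNReal.ofReal p)}
  zero_mem' := by
    have h : (fun x => (ω.toFun x : ℂ) * (0 : G → ℂ) x) = 0 := by
      funext x
      simp
    show Memℓp (fun x => (ω.toFun x : ℂ) * (0 : G → ℂ) x) (ENNReal.ofReal p)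
    rw [h]
    exact zero_memℓp
  add_mem' := by
    intro f g hf hg
    have h : (fun x => (ω.toFun x : ℂ) * (f + g) x)
        = (fun x => (ω.toFun x : ℂ) * f x) + fun x => (ω.toFun x : ℂ) * g x := by
      funext x
      simp [mul_add]
    show Memℓp (fun x => (ω.toFun x : ℂ) * (f + g) x) (ENNReal.ofReal p)
    rw [h]
    exact Memℓp.add hf hg
  smul_mem' := by
    intro c f hf
    have h : (fun x => (ω.toFun x : ℂ) * (c • f) x)
        = c • fun x => (ω.toFun x : ℂ) * f x := by
      funext x
      simp [mul_left_comm]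
    show Memℓp (fun x => (ω.toFun x : ℂ) * (c • f) x) (ENNReal.ofReal p)
    rw [h]
    exact Memℓp.const_smul hf c

/-- The weighted space `l^p_ω(G)`; below it carries the norm `‖f‖ = ‖ω f‖_p`
(and not the topology of pointwise convergence). -/
def WeightedLp {G : Type*} (ω : PosWeight G) (p : ℝ) : Type _ :=
  weightedLpSubmodule ω p

namespace WeightedLp

variable {G : Type*} {ω : PosWeight G} {p : ℝ}

noncomputable instance : AddCommGroup (WeightedLp ω p) :=
  inferInstanceAs (AddCommGroup (weightedLpSubmodule ω p))

noncomputable instance : Module ℂ (WeightedLp ω p) :=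
  inferInstanceAs (Module ℂ (weightedLpSubmodule ω p))

instance : CoeFun (WeightedLp ω p) (fun _ => G → ℂ) := ⟨fun f => f.1⟩

/-- Multiplication by the weight, as a map `l^p_ω(G) → l^p(G)`. -/
noncomputable def toLp : WeightedLp ω p →ₗ[ℂ] lp (fun _ : G => ℂ) (ENNReal.ofReal p) where
  toFun f := ⟨fun x => (ω.toFun x : ℂ) * f x, f.2⟩
  map_add' f g := by
    ext x
    exact mul_add _ (f x) (g x)
  map_smul' c f := by
    ext x
    exact mul_left_comm _ c (f x)

theorem toLp_apply (f : WeightedLp ω p) (x : G) : toLp f x = (ω.toFun x : ℂ) * f x := rfl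

theorem toLp_injective : Function.Injective (toLp : WeightedLp ω p →ₗ[ℂ] _) := by
  intro f g h
  apply Subtype.ext
  funext x
  have hx : (ω.toFun x : ℂ) * f x = (ω.toFun x : ℂ) * g x := by
    rw [← toLp_apply, ← toLp_apply, h]
  exact mul_left_cancel₀ (Complex.ofReal_ne_zero.mpr (ω.pos x).ne') hx

theorem toLp_surjective : Function.Surjective (toLp : WeightedLp ω p →ₗ[ℂ] _) := by
  intro g
  have h : (fun x => (ω.toFun x : ℂ) * ((ω.toFun x : ℂ)⁻¹ * g x)) = g := by
    funext x
    exact mul_inv_cancel_left₀ (Complex.ofReal_ne_zero.mpr (ω.pos x).ne') _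
  refine ⟨⟨fun x => (ω.toFun x : ℂ)⁻¹ * g x, ?_⟩, ?_⟩
  · show Memℓp (fun x => (ω.toFun x : ℂ) * ((ω.toFun x : ℂ)⁻¹ * g x)) (ENNReal.ofReal p)
    rw [h]
    exact g.2
  · apply Subtype.ext
    exact h

instance [Fact (1 < p)] : Fact (1 ≤ ENNReal.ofReal p) :=
  ⟨by simpa using (Fact.out : 1 < p).le⟩

/-- The norm `‖f‖ = ‖ω f‖_p`. -/
noncomputable instance [Fact (1 < p)] : NormedAddCommGroup (WeightedLp ω p) :=
  NormedAddCommGroup.induced _ _ (toLp : WeightedLp ω p →ₗ[ℂ] _) toLp_injective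

noncomputable instance [Fact (1 < p)] : NormedSpace ℂ (WeightedLp ω p) :=
  NormedSpace.induced ℂ _ _ (toLp : WeightedLp ω p →ₗ[ℂ] _)

theorem norm_def [Fact (1 < p)] (f : WeightedLp ω p) : ‖f‖ = ‖toLp f‖ := rfl

instance [Fact (1 < p)] : CompleteSpace (WeightedLp ω p) := by
  have hiso : Isometry (toLp : WeightedLp ω p →ₗ[ℂ] _) :=
    AddMonoidHomClass.isometry_of_norm _ fun f => (norm_def f).symm
  exact ((IsometryEquiv.mk (Equiv.ofBijective _ ⟨toLp_injective, toLp_surjective⟩) hiso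
    ).completeSpace_iff).mpr inferInstance

end WeightedLp

/-- A bounded bilinear map `m` on `l^p_ω(G)` is convolution: for all `f`, `g` and `x` the series
`∑ y, f y * g (x - y)` converges absolutely and its sum is `m f g x`. -/
def IsConvolution {G : Type*} [AddCommGroup G] {ω : PosWeight G} {p : ℝ} [Fact (1 < p)]
    (m : WeightedLp ω p →L[ℂ] WeightedLp ω p →L[ℂ] WeightedLp ω p) : Prop :=
  ∀ (f g : WeightedLp ω p) (x : G), HasSum (fun y => f y * g (x - y)) (m f g x)

/-- `l^p_ω(G)` is a Banach algebra under convolution: convolution is well defined on it, with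
values in it, bounded (`‖f * g‖ ≤ C ‖f‖ ‖g‖`) and associative. -/
def IsBanachConvAlgebra {G : Type*} [AddCommGroup G] (ω : PosWeight G) (p : ℝ)
    [Fact (1 < p)] : Prop :=
  CompleteSpace (WeightedLp ω p) ∧
    ∃ m : WeightedLp ω p →L[ℂ] WeightedLp ω p →L[ℂ] WeightedLp ω p,
      IsConvolution m ∧ ∀ f g h, m (m f g) h = m f (m g h)

/-- A bounded derivation `D : A → A*` for the multiplication `m` of `A`:
`D (a b) = a · D b + D a · b`, where `(a · φ) c = φ (c a)` and `(φ · b) c = φ (b c)`. -/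
def IsDualDerivation {A : Type*} [NormedAddCommGroup A] [NormedSpace ℂ A]
    (m : A →L[ℂ] A →L[ℂ] A) (D : A →L[ℂ] (A →L[ℂ] ℂ)) : Prop :=
  ∀ a b c, D (m a b) c = D b (m c a) + D a (m b c)

/-- The derivation `D` is inner: `D a = a · φ - φ · a` for some `φ ∈ A*`. -/
def IsInnerDualDerivation {A : Type*} [NormedAddCommGroup A] [NormedSpace ℂ A]
    (m : A →L[ℂ] A →L[ℂ] A) (D : A →L[ℂ] (A →L[ℂ] ℂ)) : Prop :=
  ∃ φ : A →L[ℂ] ℂ, ∀ a c, D a c = φ (m c a) - φ (m a c)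

/-- Weak amenability of `A` with the bounded multiplication `m`: every bounded derivation from
`A` into `A*` is inner. -/
def IsWeaklyAmenableMul {A : Type*} [NormedAddCommGroup A] [NormedSpace ℂ A]
    (m : A →L[ℂ] A →L[ℂ] A) : Prop :=
  ∀ D : A →L[ℂ] (A →L[ℂ] ℂ), IsDualDerivation m D → IsInnerDualDerivation m D

/-- `l^p_ω(G)`, with convolution as multiplication (there is at most one such `m`), is weakly
amenable. -/
def IsWeaklyAmenableConv {G : Type*} [AddCommGroup G] (ω : PosWeight G) (p : ℝ)
    [Fact (1 < p)] : Prop :=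
  ∃ m : WeightedLp ω p →L[ℂ] WeightedLp ω p →L[ℂ] WeightedLp ω p,
    IsConvolution m ∧ IsWeaklyAmenableMul m

/-- The length `|x| = max_i |x_i|` of `x ∈ ℤ^d`. -/
def latticeLength {d : ℕ} (x : Fin d → ℤ) : ℕ :=
  Finset.univ.sup fun i => (x i).natAbs

/-- The length is the word length for the generating set `{-1, 0, 1}^d`. -/
theorem latticeLength_eq_sInf {d : ℕ} (x : Fin d → ℤ) :
    latticeLength x
      = sInf {n : ℕ | x ∈ n • {u : Fin d → ℤ | ∀ i, u i = -1 ∨ u i = 0 ∨ u i = 1}} := by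
  have key : ∀ (n : ℕ) (x : Fin d → ℤ),
      x ∈ n • {u : Fin d → ℤ | ∀ i, u i = -1 ∨ u i = 0 ∨ u i = 1} ↔ latticeLength x ≤ n := by
    intro n
    induction n with
    | zero =>
      intro x
      simp [latticeLength, funext_iff]
    | succ n ih =>
      intro x
      rw [succ_nsmul, Set.mem_add]
      constructor
      · rintro ⟨y, hy, u, hu, rfl⟩
        rw [ih] at hy
        simp only [latticeLength, Finset.sup_le_iff, Finset.mem_univ, true_imp_iff] at hy ⊢
        intro i
        have h1 := hy i
        have h2 := hu i
        simp only [Pi.add_apply]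
        omega
      · intro hx
        simp only [latticeLength, Finset.sup_le_iff, Finset.mem_univ, true_imp_iff] at hx
        refine ⟨fun i => x i - (x i).sign, ?_, fun i => (x i).sign, ?_, ?_⟩
        · rw [ih]
          simp only [latticeLength, Finset.sup_le_iff, Finset.mem_univ, true_imp_iff]
          intro i
          have h1 := hx i
          rcases lt_trichotomy (x i) 0 with h | h | h
          · rw [Int.sign_eq_neg_one_of_neg h]
            omega
          · simp [h]
          · rw [Int.sign_eq_one_of_pos h]
            omega
        · intro i
          rcases lt_trichotomy (x i) 0 with h | h | h
          · exact Or.inl (Int.sign_eq_neg_one_of_neg h)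
          · right
            left
            simp [h]
          · exact Or.inr (Or.inr (Int.sign_eq_one_of_pos h))
        · funext i
          simp
  have hset : {n : ℕ | x ∈ n • {u : Fin d → ℤ | ∀ i, u i = -1 ∨ u i = 0 ∨ u i = 1}}
      = Set.Ici (latticeLength x) := by
    ext n
    exact key n x
  rw [hset, csInf_Ici]

/-- The polynomial weight `ω_β(x) = (1 + |x|)^β` on `ℤ^d`. -/
noncomputable def polyWeight (d : ℕ) (β : ℝ) : PosWeight (Fin d → ℤ) where
  toFun x := (1 + (latticeLength x : ℝ)) ^ β
  pos x := by positivity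

/-- The subexponential weight `σ_{α,C}(x) = exp (C |x|^α)` on `ℤ^d`. -/
noncomputable def sigmaWeight (d : ℕ) (α C : ℝ) : PosWeight (Fin d → ℤ) where
  toFun x := Real.exp (C * (latticeLength x : ℝ) ^ α)
  pos _ := Real.exp_pos _

/-- The subexponential weight `ρ_{γ,C}(x) = exp (C |x| / (log (1 + |x|))^γ)` on `ℤ^d`; for
`γ > 0` the quotient is `0 / 0 = 0` at `x = 0`, so the weight is `1` there. -/
noncomputable def rhoWeight (d : ℕ) (γ C : ℝ) : PosWeight (Fin d → ℤ) where
  toFun x := Real.exp (C * (latticeLength x : ℝ) / Real.log (1 + (latticeLength x : ℝ)) ^ γ)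
  pos _ := Real.exp_pos _

/-! By Hölder's inequality, `l^p_ω` is an algebra as soon as `(ω(y+z) / (ω(y)ω(z)))^q ≤ u(y) + u(z)`
with `u` summable (`isBanachConvAlgebra_of_rpow_le`). On `ℤ^d` it is enough to bound this ratio by a
summable function of the shorter of the two vectors. For `ω_β` that function is a multiple of
`ω_β^(-q)`; its summability is also necessary, as one sees by multiplying a truncation of `ω_β^(-q)`
with the indicator of a ball (`sum_latticeBall_rpow_neg_le`). For a weight `exp(ψ(|x|))` the
criterion becomes `ψ(n) - ψ(i) - ψ(j) ≤ K - c i^a` for `i ≤ j`, `n ≤ i + j`. This follows from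
concavity of `t^α` for `σ`, and from the decay of `1 / log^γ` for `ρ`.

The algebras are commutative, so inner derivations vanish and weak amenability means that every
bounded derivation is zero. A nonzero additive `χ : G → ℂ` gives the derivation `D f g = ∑ χ(x) f(x)
g(-x)`, which is bounded when `|χ(x)| / (ω(x)ω(-x))` lies in `l^1`, or in `l^(p/(p-2))` if `p > 2`;
`χ` is taken to be a coordinate. In the other direction, `D(δ_{nx})(δ_{z-nx})` is linear in `n` but
at most `‖D‖ ω(nx) ω(z-nx)`, which is `O(n^(2β))` for `ω_β`; hence `D = 0` when `β < 1/2`. -/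

namespace WeightedLp

variable {G : Type*} {ω : PosWeight G} {p : ℝ}

/-! ### Norm and point masses in `l^p_ω`. -/

theorem toReal_exponent [hp : Fact (1 < p)] : (ENNReal.ofReal p).toReal = p :=
  ENNReal.toReal_ofReal (zero_le_one.trans hp.out.le)

theorem norm_weight_mul (ω : PosWeight G) (f : G → ℂ) (x : G) :
    ‖(ω.toFun x : ℂ) * f x‖ = ω.toFun x * ‖f x‖ := by
  rw [norm_mul, Complex.norm_real, Real.norm_of_nonneg (ω.pos x).le]

theorem add_apply (f g : WeightedLp ω p) (x : G) : (f + g) x = f x + g x := rfl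

theorem smul_apply (c : ℂ) (f : WeightedLp ω p) (x : G) : (c • f) x = c * f x := rfl

@[ext] theorem ext {f g : WeightedLp ω p} (h : ∀ x, f x = g x) : f = g :=
  Subtype.ext (funext h)

variable [hp : Fact (1 < p)]

theorem hasSum_norm (f : WeightedLp ω p) :
    HasSum (fun x => (ω.toFun x * ‖f x‖) ^ p) (‖f‖ ^ p) := by
  have h := lp.hasSum_norm (by rw [toReal_exponent]; linarith [hp.out]) (toLp f)
  simpa only [toReal_exponent, toLp_apply, norm_weight_mul, norm_def] using h

/-- The element of `l^p_ω` given by a function with `∑ (ω |f|)^p < ∞`. -/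
def ofSummable (f : G → ℂ) (hf : Summable fun x => (ω.toFun x * ‖f x‖) ^ p) :
    WeightedLp ω p :=
  ⟨f, memℓp_gen (by simpa only [toReal_exponent, norm_weight_mul] using hf)⟩

theorem ofSummable_apply (f : G → ℂ) (hf : Summable fun x => (ω.toFun x * ‖f x‖) ^ p) (x : G) :
    (ofSummable f hf : WeightedLp ω p) x = f x := rfl

theorem norm_le_of_tsum_le {f : WeightedLp ω p} {C : ℝ} (hC : 0 ≤ C)
    (h : ∑' x, (ω.toFun x * ‖f x‖) ^ p ≤ C ^ p) : ‖f‖ ≤ C := by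
  rw [(hasSum_norm f).tsum_eq] at h
  exact (Real.rpow_le_rpow_iff (norm_nonneg _) hC (by linarith [hp.out])).1 h

theorem weight_mul_norm_apply_le (f : WeightedLp ω p) (x : G) :
    ω.toFun x * ‖f x‖ ≤ ‖f‖ := by
  rw [← norm_weight_mul, ← toLp_apply, norm_def]
  exact lp.norm_apply_le_norm (by simpa using (zero_lt_one.trans hp.out)) _ _

section single

variable [DecidableEq G]

variable (ω p) in
/-- The point mass at `x`, as an element of `l^p_ω`. -/
def delta (x : G) : WeightedLp ω p :=
  ofSummable (Pi.single x 1) <| summable_of_ne_finset_zero (s := {x}) fun y hy => by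
    rw [Pi.single_eq_of_ne (by simpa using hy), norm_zero, mul_zero,
      Real.zero_rpow (by linarith [hp.out])]

theorem delta_apply (x y : G) : delta ω p x y = if y = x then 1 else 0 := by
  rw [← Pi.single_apply]; rfl

theorem norm_delta (x : G) : ‖delta ω p x‖ = ω.toFun x := by
  have h : HasSum (fun y => (ω.toFun y * ‖delta ω p x y‖) ^ p) ((ω.toFun x) ^ p) := by
    convert hasSum_ite_eq x ((ω.toFun x) ^ p) using 2 with y
    rw [delta_apply]
    split_ifs with hy
    · simp [hy]
    · simp [Real.zero_rpow (show p ≠ 0 by linarith [hp.out])]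
  exact (Real.rpow_left_inj (norm_nonneg _) (ω.pos x).le (by linarith [hp.out])).1
    ((hasSum_norm (delta ω p x)).unique h)

theorem hasSum_delta (f : WeightedLp ω p) : HasSum (fun x => f x • delta ω p x) f := by
  have hiso : Isometry (toLp : WeightedLp ω p →ₗ[ℂ] _) :=
    AddMonoidHomClass.isometry_of_norm _ fun f => (norm_def f).symm
  rw [← hiso.isEmbedding.isInducing.hasSum_iff]
  convert lp.hasSum_single (ENNReal.ofReal_ne_top) (toLp f) using 1
  funext x
  ext y
  simp only [Function.comp, toLp_apply, smul_apply, delta_apply, lp.single_apply]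
  by_cases h : y = x
  · subst h; simp
  · simp [h]

/-- Point masses span a dense subspace because `p < ∞`. Algebraic identities for convolution and
derivations thereby reduce to identities in the group. -/
theorem clm_ext {E : Type*} [NormedAddCommGroup E] [NormedSpace ℂ E]
    {S T : WeightedLp ω p →L[ℂ] E} (h : ∀ x, S (delta ω p x) = T (delta ω p x)) : S = T := by
  ext f
  have hS := (hasSum_delta f).mapL S
  have hT := (hasSum_delta f).mapL T
  simp only [map_smul, h] at hS hT
  exact hS.unique hT

end single

end WeightedLp

/-! ### Convolution and derivations for a general weight on an abelian group. -/

namespace WeightedLp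

variable {G : Type*} [AddCommGroup G] {ω : PosWeight G} {p q : ℝ}

theorem norm_form_eq (χ : G →+ ℂ) (f g : WeightedLp ω p) (x : G) :
    ‖χ x * (f x * g (-x))‖ = (‖χ x‖ / (ω.toFun x * ω.toFun (-x)) * (ω.toFun x * ‖f x‖)) *
      (ω.toFun (-x) * ‖g (-x)‖) := by
  have h1 := (ω.pos x).ne'
  have h2 := (ω.pos (-x)).ne'
  rw [norm_mul, norm_mul]
  field_simp

variable [hp : Fact (1 < p)]

/-- Fubini for `(ω|f|)^p ⊗ (ω|g|)^p` along the shear `(x, y) ↦ (y, x - y)`. -/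
theorem hasSum_convolution_rpow (f g : WeightedLp ω p) :
    (∀ x, Summable fun y =>
      ((ω.toFun y * ‖f y‖) * (ω.toFun (x - y) * ‖g (x - y)‖)) ^ p) ∧
    HasSum (fun x => ∑' y, ((ω.toFun y * ‖f y‖) * (ω.toFun (x - y) * ‖g (x - y)‖)) ^ p)
      (‖f‖ ^ p * ‖g‖ ^ p) := by
  have hω := fun x => (ω.pos x).le
  have hprod : HasSum (fun z : G × G => (ω.toFun z.1 * ‖f z.1‖) ^ p * (ω.toFun z.2 * ‖g z.2‖) ^ p)
      (‖f‖ ^ p * ‖g‖ ^ p) :=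
    (hasSum_norm f).mul (hasSum_norm g) <|
      (hasSum_norm f).summable.mul_of_nonneg (hasSum_norm g).summable
        (fun x => Real.rpow_nonneg (mul_nonneg (hω x) (norm_nonneg _)) _)
        (fun x => Real.rpow_nonneg (mul_nonneg (hω x) (norm_nonneg _)) _)
  let e : G × G ≃ G × G :=
    { toFun := fun z => (z.2, z.1 - z.2)
      invFun := fun z => (z.1 + z.2, z.1)
      left_inv := fun z => by simp
      right_inv := fun z => by simp }
  have hprod' : HasSum (fun z : G × G =>
      ((ω.toFun z.2 * ‖f z.2‖) * (ω.toFun (z.1 - z.2) * ‖g (z.1 - z.2)‖)) ^ p)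
      (‖f‖ ^ p * ‖g‖ ^ p) := by
    rw [← e.hasSum_iff] at hprod
    refine hprod.congr_fun fun z => ?_
    exact Real.mul_rpow (mul_nonneg (hω _) (norm_nonneg _)) (mul_nonneg (hω _) (norm_nonneg _))
  have hs : ∀ x, Summable fun y =>
      ((ω.toFun y * ‖f y‖) * (ω.toFun (x - y) * ‖g (x - y)‖)) ^ p :=
    fun x => hprod'.summable.prod_factor x
  exact ⟨hs, hprod'.prod_fiberwise fun x => (hs x).hasSum⟩

/-- Hölder in `y`, after writing `ω(x) |f(y) g(x-y)|` as the product of the weighted values and the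
ratio `ω(x) / (ω(y) ω(x-y))`. The `q`-th powers of the ratio sum to at most `2 ∑ u`, uniformly in
`x`, since `y ↦ x - y` permutes the group. -/
theorem summable_convolution (hpq : p.HolderConjugate q) {u : G → ℝ} (hu : Summable u)
    (h : ∀ y z, (ω.toFun (y + z) / (ω.toFun y * ω.toFun z)) ^ q ≤ u y + u z)
    (f g : WeightedLp ω p) (x : G) :
    (Summable fun y => ‖f y * g (x - y)‖) ∧
    (ω.toFun x * ∑' y, ‖f y * g (x - y)‖) ^ p ≤
      (∑' y, ((ω.toFun y * ‖f y‖) * (ω.toFun (x - y) * ‖g (x - y)‖)) ^ p) *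
        ((2 * ∑' y, u y) ^ (1 / q)) ^ p := by
  have hω := fun x => (ω.pos x).le
  set a : G → ℝ := fun y => (ω.toFun y * ‖f y‖) * (ω.toFun (x - y) * ‖g (x - y)‖) with ha_def
  set b : G → ℝ := fun y => ω.toFun x / (ω.toFun y * ω.toFun (x - y)) with hb_def
  have ha0 : ∀ y, 0 ≤ a y := fun y =>
    mul_nonneg (mul_nonneg (hω _) (norm_nonneg _)) (mul_nonneg (hω _) (norm_nonneg _))
  have hb0 : ∀ y, 0 ≤ b y := fun y => div_nonneg (hω _) (mul_nonneg (hω _) (hω _))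
  have hbu : ∀ y, b y ^ q ≤ u y + u (x - y) := fun y => by simpa [hb_def] using h y (x - y)
  have hu' : HasSum (fun y => u y + u (x - y)) (2 * ∑' y, u y) := by
    rw [two_mul]
    exact hu.hasSum.add (((Equiv.subLeft x).hasSum_iff (f := u)).2 hu.hasSum)
  have hbs : Summable fun y => b y ^ q :=
    hu'.summable.of_nonneg_of_le (fun y => Real.rpow_nonneg (hb0 y) _) hbu
  have hbt : ∑' y, b y ^ q ≤ 2 * ∑' y, u y := hasSum_le hbu hbs.hasSum hu'
  have hb_nonneg : 0 ≤ ∑' y, b y ^ q := tsum_nonneg fun y => Real.rpow_nonneg (hb0 y) _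
  have has : Summable fun y => a y ^ p := (hasSum_convolution_rpow f g).1 x
  obtain ⟨hs, hle⟩ :=
    Real.summable_and_inner_le_Lp_mul_Lq_tsum_of_nonneg hpq ha0 hb0 has hbs
  have hab : ∀ y, a y * b y = ω.toFun x * ‖f y * g (x - y)‖ := fun y => by
    have h1 := (ω.pos y).ne'
    have h2 := (ω.pos (x - y)).ne'
    simp only [ha_def, hb_def, norm_mul]
    field_simp
  simp only [hab] at hs hle
  have hs' : Summable fun y => ‖f y * g (x - y)‖ :=
    (summable_mul_left_iff (ω.pos x).ne').1 hs
  refine ⟨hs', ?_⟩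
  rw [tsum_mul_left] at hle
  have ha_nonneg : 0 ≤ ∑' y, a y ^ p := tsum_nonneg fun y => Real.rpow_nonneg (ha0 y) _
  have hp0 : 0 < p := by linarith [hp.out]
  have hq0 : 0 < q := hpq.symm.pos
  calc (ω.toFun x * ∑' y, ‖f y * g (x - y)‖) ^ p
      ≤ ((∑' y, a y ^ p) ^ (1 / p) * (2 * ∑' y, u y) ^ (1 / q)) ^ p := by
        refine Real.rpow_le_rpow (mul_nonneg (hω _) (tsum_nonneg fun y => norm_nonneg _))
          (hle.trans ?_) hp0.le
        gcongr
    _ = _ := by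
        rw [Real.mul_rpow (by positivity) (Real.rpow_nonneg (hb_nonneg.trans hbt) _),
          ← Real.rpow_mul ha_nonneg, one_div_mul_cancel hp0.ne', Real.rpow_one]

theorem exists_isConvolution (hpq : p.HolderConjugate q) {u : G → ℝ} (hu : Summable u)
    (h : ∀ y z, (ω.toFun (y + z) / (ω.toFun y * ω.toFun z)) ^ q ≤ u y + u z) :
    ∃ m : WeightedLp ω p →L[ℂ] WeightedLp ω p →L[ℂ] WeightedLp ω p, IsConvolution m := by
  have hω := fun x => (ω.pos x).le
  have hp0 : 0 < p := by linarith [hp.out]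
  set M : ℝ := (2 * ∑' y, u y) ^ (1 / q) with hM
  have hU : 0 ≤ 2 * ∑' y, u y := by
    have : 0 ≤ ∑' y, u y := tsum_nonneg fun y => by
      have := (Real.rpow_nonneg (div_nonneg (hω _) (mul_nonneg (hω _) (hω _))) _).trans (h y y)
      linarith
    linarith
  have hM0 : 0 ≤ M := Real.rpow_nonneg hU _
  have hs := fun (f g : WeightedLp ω p) x => (summable_convolution hpq hu h f g x).1
  have hs' := fun (f g : WeightedLp ω p) x => (hs f g x).of_norm
  have hle : ∀ (f g : WeightedLp ω p) x, (ω.toFun x * ‖∑' y, f y * g (x - y)‖) ^ p ≤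
      (∑' y, ((ω.toFun y * ‖f y‖) * (ω.toFun (x - y) * ‖g (x - y)‖)) ^ p) * M ^ p :=
    fun f g x => (Real.rpow_le_rpow (mul_nonneg (hω _) (norm_nonneg _))
      (mul_le_mul_of_nonneg_left (norm_tsum_le_tsum_norm (hs f g x)) (hω x)) hp0.le).trans
        (summable_convolution hpq hu h f g x).2
  have hsum := fun f g : WeightedLp ω p => (hasSum_convolution_rpow f g).2.mul_right (M ^ p)
  have hmem : ∀ f g : WeightedLp ω p,
      Summable fun x => (ω.toFun x * ‖∑' y, f y * g (x - y)‖) ^ p := fun f g =>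
    (hsum f g).summable.of_nonneg_of_le
      (fun x => Real.rpow_nonneg (mul_nonneg (hω _) (norm_nonneg _)) _) (hle f g)
  let B : WeightedLp ω p →ₗ[ℂ] WeightedLp ω p →ₗ[ℂ] WeightedLp ω p :=
    LinearMap.mk₂ ℂ (fun f g => ofSummable (fun x => ∑' y, f y * g (x - y)) (hmem f g))
      (fun f f' g => by
        ext x
        simp only [add_apply, ofSummable_apply, add_mul]
        exact (hs' f g x).tsum_add (hs' f' g x))
      (fun c f g => by
        ext x
        simp only [smul_apply, ofSummable_apply, mul_assoc, tsum_mul_left])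
      (fun f g g' => by
        ext x
        simp only [add_apply, ofSummable_apply, mul_add]
        exact (hs' f g x).tsum_add (hs' f g' x))
      (fun c f g => by
        ext x
        simp only [smul_apply, ofSummable_apply, mul_left_comm _ c, tsum_mul_left])
  refine ⟨B.mkContinuous₂ M fun f g => ?_, fun f g x => (hs' f g x).hasSum⟩
  refine norm_le_of_tsum_le (by positivity) ?_
  rw [Real.mul_rpow (by positivity) (norm_nonneg _), Real.mul_rpow hM0 (norm_nonneg _)]
  refine (hasSum_le (hle f g) (hmem f g).hasSum (hsum f g)).trans_eq ?_
  ring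

section delta

variable [DecidableEq G] {m : WeightedLp ω p →L[ℂ] WeightedLp ω p →L[ℂ] WeightedLp ω p}

theorem _root_.IsConvolution.delta_delta (hm : IsConvolution m) (x y : G) :
    m (delta ω p x) (delta ω p y) = delta ω p (x + y) := by
  ext z
  refine (hm _ _ z).unique ?_
  convert hasSum_ite_eq x (delta ω p (x + y) z) using 2 with w
  simp only [delta_apply]
  by_cases h : w = x
  · subst h
    simp [sub_eq_iff_eq_add, add_comm]
  · simp [h]

theorem _root_.IsConvolution.comm (hm : IsConvolution m) (f g : WeightedLp ω p) :
    m f g = m g f := by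
  have h : m = m.flip := clm_ext fun x => clm_ext fun y => by
    rw [ContinuousLinearMap.flip_apply, hm.delta_delta, hm.delta_delta, add_comm]
  exact DFunLike.congr_fun (DFunLike.congr_fun h f) g

theorem _root_.IsConvolution.assoc (hm : IsConvolution m) (f g h : WeightedLp ω p) :
    m (m f g) h = m f (m g h) := by
  -- The identity is extended from point masses to arbitrary elements one variable at a time,
  -- starting with the last.
  have h1 : ∀ x y, m (m (delta ω p x) (delta ω p y)) =
      (m (delta ω p x)).comp (m (delta ω p y)) := fun x y => clm_ext fun z => by
    simp only [ContinuousLinearMap.comp_apply, hm.delta_delta, add_assoc]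
  have h2 : ∀ x h, (m.flip h).comp (m (delta ω p x)) = (m (delta ω p x)).comp (m.flip h) :=
    fun x h => clm_ext fun y => DFunLike.congr_fun (h1 x y) h
  have h3 : (m.flip h).comp (m.flip g) = m.flip (m g h) :=
    clm_ext fun x => DFunLike.congr_fun (h2 x h) g
  exact DFunLike.congr_fun h3 f

theorem _root_.IsConvolution.isDualDerivation (hm : IsConvolution m)
    (D : WeightedLp ω p →L[ℂ] (WeightedLp ω p →L[ℂ] ℂ))
    (hD : ∀ x y z, D (delta ω p (x + y)) (delta ω p z) =
      D (delta ω p y) (delta ω p (z + x)) + D (delta ω p x) (delta ω p (y + z))) :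
    IsDualDerivation m D := by
  intro f g h
  have h1 : ∀ x y, D (m (delta ω p x) (delta ω p y)) =
      (D (delta ω p y)).comp (m.flip (delta ω p x)) +
        (D (delta ω p x)).comp (m (delta ω p y)) := fun x y => clm_ext fun z => by
    simpa [hm.delta_delta] using hD x y z
  have h2 : ∀ x h, (D.flip h).comp (m (delta ω p x)) =
      D.flip (m h (delta ω p x)) + (D (delta ω p x)).comp (m.flip h) :=
    fun x h => clm_ext fun y => DFunLike.congr_fun (h1 x y) h
  have h3 : (D.flip h).comp (m.flip g) = (D g).comp (m h) + D.flip (m g h) :=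
    clm_ext fun x => DFunLike.congr_fun (h2 x h) g
  exact DFunLike.congr_fun h3 f

end delta

theorem isBanachConvAlgebra_of_rpow_le (hpq : p.HolderConjugate q) {u : G → ℝ} (hu : Summable u)
    (h : ∀ y z, (ω.toFun (y + z) / (ω.toFun y * ω.toFun z)) ^ q ≤ u y + u z) :
    IsBanachConvAlgebra ω p := by
  classical
  obtain ⟨m, hm⟩ := exists_isConvolution hpq hu h
  exact ⟨inferInstance, m, hm, hm.assoc⟩

/-- A nonzero character `χ : G → ℂ` gives the nonzero derivation
`D f g = ∑ x, χ x * f x * g (-x)` as soon as this form is bounded. -/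
theorem not_isWeaklyAmenableConv_of_bound (χ : G →+ ℂ) (hχ : χ ≠ 0) {M : ℝ}
    (h : ∀ f g : WeightedLp ω p, (Summable fun x => ‖χ x * (f x * g (-x))‖) ∧
      ∑' x, ‖χ x * (f x * g (-x))‖ ≤ M * ‖f‖ * ‖g‖) :
    ¬ IsWeaklyAmenableConv ω p := by
  classical
  rintro ⟨m, hm, hwa⟩
  have hs := fun f g => (h f g).1.of_norm
  let B : WeightedLp ω p →ₗ[ℂ] WeightedLp ω p →ₗ[ℂ] ℂ :=
    LinearMap.mk₂ ℂ (fun f g => ∑' x, χ x * (f x * g (-x)))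
      (fun f f' g => by
        simp only [add_apply, add_mul, mul_add]
        exact (hs f g).tsum_add (hs f' g))
      (fun c f g => by
        simp only [smul_apply, mul_assoc, mul_left_comm _ c, tsum_mul_left, smul_eq_mul])
      (fun f g g' => by
        simp only [add_apply, mul_add]
        exact (hs f g).tsum_add (hs f g'))
      (fun c f g => by
        simp only [smul_apply, mul_left_comm _ c, tsum_mul_left, smul_eq_mul])
  let D : WeightedLp ω p →L[ℂ] (WeightedLp ω p →L[ℂ] ℂ) :=
    B.mkContinuous₂ M fun f g => (norm_tsum_le_tsum_norm (h f g).1).trans (h f g).2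
  have hD : ∀ x y, D (delta ω p x) (delta ω p y) = if x + y = 0 then χ x else 0 := by
    intro x y
    show ∑' z, χ z * (delta ω p x z * delta ω p y (-z)) = _
    rw [tsum_eq_single x fun z hz => by simp [delta_apply, hz]]
    have : -x = y ↔ x + y = 0 := neg_eq_iff_add_eq_zero
    simp [delta_apply, this]
  have hder : IsDualDerivation m D := hm.isDualDerivation D fun x y z => by
    rw [hD, hD, hD]
    have e1 : y + (z + x) = x + y + z := by abel
    have e2 : x + (y + z) = x + y + z := by abel
    rw [e1, e2]
    split_ifs
    · rw [map_add, add_comm]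
    · simp
  obtain ⟨φ, hφ⟩ := hwa D hder
  -- By commutativity the inner derivation vanishes, while `D δ_x δ_{-x} = χ(x)`.
  refine hχ (AddMonoidHom.ext fun x => ?_)
  have h0 := hφ (delta ω p x) (delta ω p (-x))
  rwa [hm.comm, sub_self, hD, if_pos (add_neg_cancel x)] at h0

theorem not_isWeaklyAmenableConv_of_summable (χ : G →+ ℂ) (hχ : χ ≠ 0)
    (h : Summable fun x => ‖χ x‖ / (ω.toFun x * ω.toFun (-x))) :
    ¬ IsWeaklyAmenableConv ω p := by
  have hω := fun x => (ω.pos x).le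
  refine not_isWeaklyAmenableConv_of_bound χ hχ
    (M := ∑' x, ‖χ x‖ / (ω.toFun x * ω.toFun (-x))) fun f g => ?_
  have hle : ∀ x, ‖χ x * (f x * g (-x))‖ ≤
      ‖χ x‖ / (ω.toFun x * ω.toFun (-x)) * (‖f‖ * ‖g‖) := fun x => by
    rw [norm_form_eq, mul_assoc]
    exact mul_le_mul_of_nonneg_left
      (mul_le_mul (weight_mul_norm_apply_le f x) (weight_mul_norm_apply_le g (-x))
        (mul_nonneg (hω _) (norm_nonneg _)) (norm_nonneg _))
      (div_nonneg (norm_nonneg _) (mul_nonneg (hω _) (hω _)))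
  have hs := (h.mul_right (‖f‖ * ‖g‖)).of_nonneg_of_le (fun x => norm_nonneg _) hle
  refine ⟨hs, ?_⟩
  rw [mul_assoc, ← tsum_mul_right]
  exact hs.tsum_le_tsum hle (h.mul_right _)

theorem not_isWeaklyAmenableConv_of_summable_rpow (hp2 : 2 < p) (χ : G →+ ℂ) (hχ : χ ≠ 0)
    (h : Summable fun x => (‖χ x‖ / (ω.toFun x * ω.toFun (-x))) ^ (p / (p - 2))) :
    ¬ IsWeaklyAmenableConv ω p := by
  have hω := fun x => (ω.pos x).le
  have hp0 : 0 < p := by linarith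
  have hpq : p.HolderConjugate (p / (p - 1)) := .conjExponent hp.out
  -- `(p-2)/p + 1/p = (p-1)/p`: the kernel times `ω f` lies in the space dual to `l^p`, so a second
  -- Hölder pairs it with `g`.
  have htriple : (p / (p - 2)).HolderTriple p (p / (p - 1)) := by
    refine ⟨?_, div_pos hp0 (by linarith), hp0⟩
    have h1 : p - 2 ≠ 0 := by linarith
    have h2 : p - 1 ≠ 0 := by linarith
    field_simp
    ring
  set κ : G → ℝ := fun x => ‖χ x‖ / (ω.toFun x * ω.toFun (-x)) with hκ_def
  have hκ0 : ∀ x, 0 ≤ κ x := fun x => div_nonneg (norm_nonneg _) (mul_nonneg (hω _) (hω _))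
  have hroot : ∀ f : WeightedLp ω p, (∑' x, (ω.toFun x * ‖f x‖) ^ p) ^ (1 / p) = ‖f‖ := fun f => by
    rw [(hasSum_norm f).tsum_eq, one_div, Real.rpow_rpow_inv (norm_nonneg _) hp0.ne']
  refine not_isWeaklyAmenableConv_of_bound χ hχ
    (M := (∑' x, κ x ^ (p / (p - 2))) ^ (1 / (p / (p - 2)))) fun f g => ?_
  have hf0 : ∀ x, 0 ≤ ω.toFun x * ‖f x‖ := fun x => mul_nonneg (hω _) (norm_nonneg _)
  have hg0 : ∀ x, 0 ≤ ω.toFun (-x) * ‖g (-x)‖ := fun x => mul_nonneg (hω _) (norm_nonneg _)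
  have hg : HasSum (fun x => (ω.toFun (-x) * ‖g (-x)‖) ^ p) (‖g‖ ^ p) :=
    ((Equiv.neg G).hasSum_iff (f := fun x => (ω.toFun x * ‖g x‖) ^ p)).2 (hasSum_norm g)
  have hgroot : (∑' x, (ω.toFun (-x) * ‖g (-x)‖) ^ p) ^ (1 / p) = ‖g‖ := by
    rw [hg.tsum_eq, one_div, Real.rpow_rpow_inv (norm_nonneg _) hp0.ne']
  have hs1 := Real.summable_Lr_of_Lp_Lq_of_nonneg htriple hκ0 hf0 h
    (hasSum_norm f).summable
  have hle1 := Real.Lr_le_Lp_mul_Lq_tsum_of_nonneg htriple hκ0 hf0 h (hasSum_norm f).summable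
  obtain ⟨hs2, hle2⟩ := Real.summable_and_inner_le_Lp_mul_Lq_tsum_of_nonneg hpq.symm
    (fun x => mul_nonneg (hκ0 x) (hf0 x)) hg0 hs1 hg.summable
  simp only [norm_form_eq]
  refine ⟨hs2, hle2.trans ?_⟩
  rw [hgroot]
  rw [hroot] at hle1
  exact mul_le_mul_of_nonneg_right hle1 (norm_nonneg _)

/-- If `ω (n x) ω (z - n x) = o(n)` for all `x`, `z`, then every bounded derivation vanishes. -/
theorem isWeaklyAmenableConv_of_tendsto (halg : IsBanachConvAlgebra ω p)
    (h : ∀ x z : G, Filter.Tendsto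
      (fun n : ℕ => ω.toFun (n • x) * ω.toFun (z - n • x) / n) Filter.atTop (nhds 0)) :
    IsWeaklyAmenableConv ω p := by
  classical
  obtain ⟨-, m, hm, -⟩ := halg
  refine ⟨m, hm, fun D hD => ?_⟩
  have hadd : ∀ x y z, D (delta ω p (x + y)) (delta ω p z) =
      D (delta ω p y) (delta ω p (z + x)) + D (delta ω p x) (delta ω p (y + z)) := fun x y z => by
    have := hD (delta ω p x) (delta ω p y) (delta ω p z)
    rwa [hm.delta_delta, hm.delta_delta, hm.delta_delta] at this
  have hmul : ∀ (x z : G) (n : ℕ), D (delta ω p (n • x)) (delta ω p (z - n • x)) =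
      n * D (delta ω p x) (delta ω p (z - x)) := by
    intro x z n
    induction n with
    -- At `x = y = 0` the derivation rule reads `t = t + t`.
    | zero => simpa using hadd 0 0 z
    | succ n ih =>
      have := hadd (n • x) x (z - (n + 1) • x)
      have e1 : z - (n + 1) • x + n • x = z - x := by rw [succ_nsmul]; abel
      have e2 : x + (z - (n + 1) • x) = z - n • x := by rw [succ_nsmul]; abel
      rw [e1, e2, ih, ← succ_nsmul] at this
      rw [this]
      push_cast
      ring
  have hzero : ∀ x z, D (delta ω p x) (delta ω p (z - x)) = 0 := by
    intro x z
    rw [← norm_le_zero_iff]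
    have hlim := (h x z).const_mul ‖D‖
    rw [mul_zero] at hlim
    refine ge_of_tendsto hlim ?_
    filter_upwards [Filter.eventually_gt_atTop 0] with n hn
    have hn' : (0 : ℝ) < n := by exact_mod_cast hn
    have hb := D.le_opNorm₂ (delta ω p (n • x)) (delta ω p (z - n • x))
    rw [hmul, norm_delta, norm_delta, norm_mul, Complex.norm_natCast] at hb
    rw [← mul_div_assoc, le_div_iff₀ hn']
    linarith
  have hD0 : D = 0 := clm_ext fun x => clm_ext fun y => by
    simpa using hzero x (y + x)
  exact ⟨0, fun a c => by simp [hD0]⟩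

end WeightedLp

/-! ### Lattice point counts and summability on `ℤ^d`. -/

section latticeLength

variable {d : ℕ}

theorem latticeLength_le_iff {x : Fin d → ℤ} {n : ℕ} :
    latticeLength x ≤ n ↔ ∀ i, (x i).natAbs ≤ n := by
  simp [latticeLength]

theorem natAbs_le_latticeLength (x : Fin d → ℤ) (i : Fin d) :
    (x i).natAbs ≤ latticeLength x :=
  latticeLength_le_iff.1 le_rfl i

theorem latticeLength_add_le (x y : Fin d → ℤ) :
    latticeLength (x + y) ≤ latticeLength x + latticeLength y :=
  latticeLength_le_iff.2 fun i => by
    have h1 := natAbs_le_latticeLength x i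
    have h2 := natAbs_le_latticeLength y i
    rw [Pi.add_apply]
    omega

theorem latticeLength_neg (x : Fin d → ℤ) : latticeLength (-x) = latticeLength x := by
  simp [latticeLength]

theorem latticeLength_nsmul_le (n : ℕ) (x : Fin d → ℤ) :
    latticeLength (n • x) ≤ n * latticeLength x :=
  latticeLength_le_iff.2 fun i => by
    rw [Pi.smul_apply, nsmul_eq_mul, Int.natAbs_mul, Int.natAbs_natCast]
    exact Nat.mul_le_mul_left _ (natAbs_le_latticeLength x i)

theorem norm_coord_le_latticeLength (x : Fin d → ℤ) (i : Fin d) :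
    ‖((x i : ℤ) : ℂ)‖ ≤ latticeLength x := by
  rw [Complex.norm_intCast, ← Int.cast_abs, Int.abs_eq_natAbs]
  exact_mod_cast natAbs_le_latticeLength x i

/-- The ball of radius `n` for `latticeLength`. -/
noncomputable def latticeBall (d n : ℕ) : Finset (Fin d → ℤ) :=
  Fintype.piFinset fun _ => Finset.Icc (-n : ℤ) n

theorem mem_latticeBall {n : ℕ} {x : Fin d → ℤ} : x ∈ latticeBall d n ↔ latticeLength x ≤ n := by
  rw [latticeBall, Fintype.mem_piFinset, latticeLength_le_iff]
  refine forall_congr' fun i => ?_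
  rw [Finset.mem_Icc]
  omega

theorem card_latticeBall (d n : ℕ) : (latticeBall d n).card = (2 * n + 1) ^ d := by
  rw [latticeBall, Fintype.card_piFinset, Finset.prod_const, Int.card_Icc, Finset.card_univ,
    Fintype.card_fin]
  congr 1
  omega

theorem exists_subset_latticeBall (s : Finset (Fin d → ℤ)) :
    ∃ N, ∀ n, N ≤ n → s ⊆ latticeBall d n :=
  ⟨s.sup latticeLength, fun _ hn _ hx => mem_latticeBall.2 ((Finset.le_sup hx).trans hn)⟩

/-- A cube of points whose length lies between `n` and `2 * n`. -/
noncomputable def latticeBox (d n : ℕ) : Finset (Fin d → ℤ) :=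
  Fintype.piFinset fun _ => Finset.Icc (n : ℤ) (2 * n)

theorem card_latticeBox (d n : ℕ) : (latticeBox d n).card = (n + 1) ^ d := by
  rw [latticeBox, Fintype.card_piFinset, Finset.prod_const, Int.card_Icc, Finset.card_univ,
    Fintype.card_fin]
  congr 1
  omega

theorem le_latticeLength_of_mem_latticeBox (hd : 1 ≤ d) {n : ℕ} {x : Fin d → ℤ}
    (hx : x ∈ latticeBox d n) : n ≤ latticeLength x := by
  have h := Finset.mem_Icc.1 (Fintype.mem_piFinset.1 hx ⟨0, hd⟩)
  have := natAbs_le_latticeLength x ⟨0, hd⟩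
  omega

theorem latticeLength_le_of_mem_latticeBox {n : ℕ} {x : Fin d → ℤ}
    (hx : x ∈ latticeBox d n) : latticeLength x ≤ 2 * n :=
  latticeLength_le_iff.2 fun i => by
    have h := Finset.mem_Icc.1 (Fintype.mem_piFinset.1 hx i)
    omega

theorem summable_one_add_natAbs_rpow {s : ℝ} (hs : 1 < s) :
    Summable fun k : ℤ => (1 + (k.natAbs : ℝ)) ^ (-s) := by
  have h : Summable fun n : ℕ => (1 + (n : ℝ)) ^ (-s) := by
    have := (summable_nat_add_iff 1).2 (Real.summable_nat_rpow.2 (neg_lt_neg hs))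
    simpa [add_comm] using this
  exact Summable.of_nat_of_neg (by simpa using h) (by simpa using h)

/-- Since `|x| ≥ |x_i|` for each `i`, the term is at most `∏ (1 + |x_i|)^(-s/d)`, a product of
convergent one-dimensional series. -/
theorem summable_one_add_latticeLength_rpow (hd : 1 ≤ d) {s : ℝ} (hs : d < s) :
    Summable fun x : Fin d → ℤ => (1 + (latticeLength x : ℝ)) ^ (-s) := by
  have hd0 : (0 : ℝ) < d := by exact_mod_cast hd
  have h1 := summable_one_add_natAbs_rpow ((one_lt_div hd0).2 hs)
  refine summable_of_sum_le (c := (∑' k : ℤ, (1 + (k.natAbs : ℝ)) ^ (-(s / d))) ^ d)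
    (fun x => by positivity) fun S => ?_
  obtain ⟨N, hN⟩ := exists_subset_latticeBall S
  calc ∑ x ∈ S, (1 + (latticeLength x : ℝ)) ^ (-s)
      ≤ ∑ x ∈ latticeBall d N, (1 + (latticeLength x : ℝ)) ^ (-s) :=
        Finset.sum_le_sum_of_subset_of_nonneg (hN N le_rfl) fun _ _ _ => by positivity
    _ ≤ ∑ x ∈ latticeBall d N, ∏ i, (1 + ((x i).natAbs : ℝ)) ^ (-(s / d)) := by
        refine Finset.sum_le_sum fun x _ => ?_
        calc (1 + (latticeLength x : ℝ)) ^ (-s)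
            = ∏ _i : Fin d, (1 + (latticeLength x : ℝ)) ^ (-(s / d)) := by
              rw [Finset.prod_const, Finset.card_univ, Fintype.card_fin, ← Real.rpow_mul_natCast
                (by positivity)]
              congr 1
              field_simp
          _ ≤ _ := by
              refine Finset.prod_le_prod (fun _ _ => by positivity) fun i _ => ?_
              refine Real.rpow_le_rpow_of_nonpos (by positivity) ?_
                (neg_nonpos.2 (div_nonneg (hd0.le.trans hs.le) hd0.le))
              have : ((x i).natAbs : ℝ) ≤ latticeLength x := by
                exact_mod_cast natAbs_le_latticeLength x i
              linarith
    _ = ∏ _i : Fin d, ∑ k ∈ Finset.Icc (-N : ℤ) N, (1 + (k.natAbs : ℝ)) ^ (-(s / d)) :=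
        (Finset.prod_univ_sum (fun _ => Finset.Icc (-N : ℤ) N)
          fun _ (k : ℤ) => (1 + (k.natAbs : ℝ)) ^ (-(s / d))).symm
    _ ≤ ∏ _i : Fin d, ∑' k : ℤ, (1 + (k.natAbs : ℝ)) ^ (-(s / d)) :=
        Finset.prod_le_prod (fun _ _ => Finset.sum_nonneg fun _ _ => by positivity) fun _ _ =>
          h1.sum_le_tsum _ fun _ _ => by positivity
    _ = _ := by simp

/-- If `s ≤ d`, the boxes `[n, 2n]^d` escape every finite set, yet each contributes at least `2^(-s)
(n+1)^(d-s) ≥ 2^(-s)`, against the Cauchy criterion. -/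
theorem lt_of_summable_one_add_latticeLength_rpow (hd : 1 ≤ d) {s : ℝ} (hs0 : 0 ≤ s)
    (h : Summable fun x : Fin d → ℤ => (1 + (latticeLength x : ℝ)) ^ (-s)) : d < s := by
  by_contra! hs
  obtain ⟨S, hS⟩ := summable_iff_vanishing_norm.1 h (2 ^ (-s)) (by positivity)
  obtain ⟨N, hN⟩ := exists_subset_latticeBall S
  have hdisj : Disjoint (latticeBox d (N + 1)) S := by
    refine Finset.disjoint_left.2 fun x hx hxS => ?_
    have h1 := le_latticeLength_of_mem_latticeBox hd hx
    have h2 := mem_latticeBall.1 (hN N le_rfl hxS)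
    omega
  have hlt := (Real.le_norm_self _).trans_lt (hS _ hdisj)
  have hterm : ∀ x ∈ latticeBox d (N + 1), (2 * ((N + 1 : ℕ) + 1 : ℝ)) ^ (-s) ≤
      (1 + (latticeLength x : ℝ)) ^ (-s) := fun x hx => by
    refine Real.rpow_le_rpow_of_nonpos (by positivity) ?_ (neg_nonpos.2 hs0)
    have : (latticeLength x : ℝ) ≤ 2 * (N + 1 : ℕ) := by
      exact_mod_cast latticeLength_le_of_mem_latticeBox hx
    linarith
  have hge := Finset.card_nsmul_le_sum _ _ _ hterm
  rw [card_latticeBox, nsmul_eq_mul, Real.mul_rpow (by positivity) (by positivity)] at hge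
  push_cast at hge hlt
  have hone : (1 : ℝ) ≤ ((N : ℝ) + 1 + 1) ^ d * ((N : ℝ) + 1 + 1) ^ (-s) := by
    rw [← Real.rpow_natCast, ← Real.rpow_add (by positivity)]
    exact Real.one_le_rpow (by linarith [N.cast_nonneg (α := ℝ)]) (by linarith)
  have h2 : (0 : ℝ) < 2 ^ (-s) := by positivity
  nlinarith

end latticeLength

/-! ### Stretched exponentials decay faster than any power. -/

theorem exists_exp_neg_rpow_le {c a : ℝ} (hc : 0 < c) (ha : 0 < a) (k : ℝ) :
    ∃ K, 0 ≤ K ∧ ∀ n : ℕ, Real.exp (-(c * (n : ℝ) ^ a)) ≤ K * (1 + (n : ℝ)) ^ (-k) := by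
  obtain ⟨m, hm⟩ := exists_nat_ge (k / a)
  rw [div_le_iff₀ ha] at hm
  -- The factor `(1/2)^a` comes from `(1 + n)/2 ≤ n` for `n ≥ 1`; the case `n = 0` is absorbed by
  -- the factor `exp c`.
  set c' := c * (1 / 2) ^ a with hc'
  have hc'0 : 0 < c' := by positivity
  refine ⟨Real.exp c * (m.factorial / c' ^ m), by positivity, fun n => ?_⟩
  have h1 : (1 / 2 : ℝ) ^ a * (1 + (n : ℝ)) ^ a ≤ 1 + (n : ℝ) ^ a := by
    rw [← Real.mul_rpow (by norm_num) (by positivity)]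
    rcases Nat.eq_zero_or_pos n with rfl | hn
    · have : (1 / 2 : ℝ) ^ a ≤ 1 := Real.rpow_le_one (by norm_num) (by norm_num) ha.le
      simpa [Real.zero_rpow ha.ne'] using this
    · have hn' : (1 : ℝ) ≤ n := by exact_mod_cast hn
      have := Real.rpow_le_rpow (by positivity) (show 1 / 2 * (1 + (n : ℝ)) ≤ n by linarith) ha.le
      linarith
  have h2 := Real.pow_div_factorial_le_exp (c' * (1 + (n : ℝ)) ^ a) (by positivity) m
  have h3 : (1 + (n : ℝ)) ^ k ≤ ((1 + (n : ℝ)) ^ a) ^ m := by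
    rw [← Real.rpow_mul_natCast (by positivity)]
    exact Real.rpow_le_rpow_of_exponent_le (by linarith [n.cast_nonneg (α := ℝ)]) (by linarith)
  have h4 : Real.exp (-(c * (n : ℝ) ^ a)) ≤
      Real.exp c * Real.exp (-(c' * (1 + (n : ℝ)) ^ a)) := by
    rw [← Real.exp_add, Real.exp_le_exp, hc']
    nlinarith
  refine h4.trans ?_
  rw [mul_assoc (Real.exp c) (_ / _)]
  refine mul_le_mul_of_nonneg_left ?_ (Real.exp_pos _).le
  rw [Real.exp_neg, Real.rpow_neg (by positivity)]
  have h5 : c' ^ m / m.factorial * (1 + (n : ℝ)) ^ k ≤ Real.exp (c' * (1 + (n : ℝ)) ^ a) := by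
    refine le_trans ?_ h2
    rw [div_mul_eq_mul_div, mul_pow c' _ m]
    gcongr
  refine (inv_anti₀ (by positivity) h5).trans_eq ?_
  rw [mul_inv, inv_div]

theorem summable_exp_neg_latticeLength_rpow {d : ℕ} (hd : 1 ≤ d) {c a : ℝ} (hc : 0 < c)
    (ha : 0 < a) :
    Summable fun x : Fin d → ℤ =>
      (1 + (latticeLength x : ℝ)) * Real.exp (-(c * (latticeLength x : ℝ) ^ a)) := by
  -- One power is spent on the factor `1 + |x|`, which will dominate the coordinate character; `d +
  -- 1 > d` powers remain.
  obtain ⟨K, hK, h⟩ := exists_exp_neg_rpow_le hc ha (d + 2)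
  refine ((summable_one_add_latticeLength_rpow hd
    (lt_add_one (d : ℝ))).mul_left K).of_nonneg_of_le (fun x => by positivity) fun x => ?_
  refine (mul_le_mul_of_nonneg_left (h _) (by positivity)).trans_eq ?_
  rw [show -((d : ℝ) + 1) = 1 + -((d : ℝ) + 2) by ring, Real.rpow_add (by positivity),
    Real.rpow_one]
  ring

/-! ### Polynomial weights. -/

section polyWeight

variable {d : ℕ} {p q : ℝ}

theorem polyWeight_apply (β : ℝ) (x : Fin d → ℤ) :
    (polyWeight d β).toFun x = (1 + (latticeLength x : ℝ)) ^ β := rfl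

theorem memℓp_one_div_polyWeight_iff_summable (hq : 0 < q) (β : ℝ) :
    Memℓp (fun x => 1 / (polyWeight d β).toFun x) (ENNReal.ofReal q) ↔
      Summable fun x : Fin d → ℤ => (1 + (latticeLength x : ℝ)) ^ (-(β * q)) := by
  have hq' : (ENNReal.ofReal q).toReal = q := ENNReal.toReal_ofReal hq.le
  rw [memℓp_gen_iff (by rwa [hq']), hq']
  refine summable_congr fun x => ?_
  rw [Real.norm_of_nonneg (one_div_pos.2 ((polyWeight d β).pos x)).le, polyWeight_apply, one_div,
    ← Real.rpow_neg (by positivity), ← Real.rpow_mul (by positivity), neg_mul]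

theorem memℓp_one_div_polyWeight_iff_lt (hd : 1 ≤ d) (hq : 0 < q) {β : ℝ} (hβ : 0 ≤ β) :
    Memℓp (fun x => 1 / (polyWeight d β).toFun x) (ENNReal.ofReal q) ↔ d / q < β := by
  rw [memℓp_one_div_polyWeight_iff_summable hq, div_lt_iff₀ hq]
  exact ⟨lt_of_summable_one_add_latticeLength_rpow hd (by positivity),
    summable_one_add_latticeLength_rpow hd⟩

theorem isBanachConvAlgebra_of_latticeLength_le [Fact (1 < p)] (hpq : p.HolderConjugate q)
    {ω : PosWeight (Fin d → ℤ)} {u : (Fin d → ℤ) → ℝ} (hu : Summable u) (hu0 : ∀ x, 0 ≤ u x)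
    (h : ∀ y z, latticeLength y ≤ latticeLength z →
      (ω.toFun (y + z) / (ω.toFun y * ω.toFun z)) ^ q ≤ u y) :
    IsBanachConvAlgebra ω p := by
  refine WeightedLp.isBanachConvAlgebra_of_rpow_le hpq hu fun y z => ?_
  rcases le_total (latticeLength y) (latticeLength z) with hyz | hyz
  · exact (h y z hyz).trans (le_add_of_nonneg_right (hu0 z))
  · have := h z y hyz
    rw [add_comm z, mul_comm (ω.toFun z)] at this
    exact this.trans (le_add_of_nonneg_left (hu0 y))

theorem isBanachConvAlgebra_polyWeight [Fact (1 < p)] (hpq : p.HolderConjugate q) {β : ℝ}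
    (hβ : 0 ≤ β)
    (h : Memℓp (fun x => 1 / (polyWeight d β).toFun x) (ENNReal.ofReal q)) :
    IsBanachConvAlgebra (polyWeight d β) p := by
  have hq : 0 < q := hpq.symm.pos
  rw [memℓp_one_div_polyWeight_iff_summable hq] at h
  refine isBanachConvAlgebra_of_latticeLength_le hpq (h.mul_left (2 ^ (β * q)))
    (fun x => by positivity) fun y z hyz => ?_
  have h1 : (latticeLength (y + z) : ℝ) ≤ latticeLength y + latticeLength z := by
    exact_mod_cast latticeLength_add_le y z
  have h2 : (latticeLength y : ℝ) ≤ latticeLength z := by exact_mod_cast hyz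
  simp only [polyWeight_apply]
  rw [← Real.mul_rpow (by positivity) (by positivity), ← Real.div_rpow (by positivity)
    (by positivity), ← Real.rpow_mul (by positivity), Real.rpow_neg (by positivity),
    ← div_eq_mul_inv, ← Real.div_rpow (by positivity) (by positivity)]
  -- For `|y| ≤ |z|` one has `1 + |y+z| ≤ 2 (1 + |z|)`, which accounts for the constant `2^(βq)`.
  refine Real.rpow_le_rpow (by positivity) ?_ (by positivity)
  rw [div_le_div_iff₀ (by positivity) (by positivity)]
  nlinarith [(latticeLength y).cast_nonneg (α := ℝ)]

/-- A doubling estimate: both sides are comparable to `(N+1)^(d+s)`, the lower bound coming from the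
box `[N, 2N]^d` alone. -/
theorem sum_latticeBall_rpow_le (hd : 1 ≤ d) {s : ℝ} (hs : 0 ≤ s) (N : ℕ) :
    ∑ x ∈ latticeBall d (4 * N), (1 + (latticeLength x : ℝ)) ^ s ≤
      8 ^ d * 4 ^ s * ∑ x ∈ latticeBall d (2 * N), (1 + (latticeLength x : ℝ)) ^ s := by
  have hupper : ∑ x ∈ latticeBall d (4 * N), (1 + (latticeLength x : ℝ)) ^ s ≤
      (8 * (N + 1)) ^ d * (4 ^ s * (1 + (N : ℝ)) ^ s) := by
    refine (Finset.sum_le_card_nsmul _ _ ((4 * (1 + (N : ℝ))) ^ s) fun x hx => ?_).trans ?_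
    · refine Real.rpow_le_rpow (by positivity) ?_ hs
      have : (latticeLength x : ℝ) ≤ 4 * N := by exact_mod_cast mem_latticeBall.1 hx
      linarith
    · rw [card_latticeBall, nsmul_eq_mul, Real.mul_rpow (by positivity) (by positivity)]
      push_cast
      gcongr
      linarith
  have hlower : (N + 1 : ℝ) ^ d * (1 + (N : ℝ)) ^ s ≤
      ∑ x ∈ latticeBall d (2 * N), (1 + (latticeLength x : ℝ)) ^ s := by
    have hsub : latticeBox d N ⊆ latticeBall d (2 * N) := fun x hx =>
      mem_latticeBall.2 (latticeLength_le_of_mem_latticeBox hx)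
    refine le_trans ?_ (Finset.sum_le_sum_of_subset_of_nonneg hsub fun _ _ _ => by positivity)
    refine le_trans (le_of_eq ?_) (Finset.card_nsmul_le_sum _ _ ((1 + (N : ℝ)) ^ s) fun x hx => ?_)
    · rw [card_latticeBox, nsmul_eq_mul]
      push_cast
      rfl
    · refine Real.rpow_le_rpow (by positivity) ?_ hs
      have : (N : ℝ) ≤ latticeLength x := by
        exact_mod_cast le_latticeLength_of_mem_latticeBox hd hx
      linarith
  refine hupper.trans (le_trans (le_of_eq ?_) (mul_le_mul_of_nonneg_left hlower (by positivity)))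
  rw [mul_pow]
  ring

/-- The finitely supported element `∑ x ∈ s, a x δ_x` of `l^p_ω`. -/
theorem WeightedLp.exists_finset_apply {G : Type*} [DecidableEq G] (ω : PosWeight G)
    [hp : Fact (1 < p)] (s : Finset G) (a : G → ℝ) :
    ∃ f : WeightedLp ω p, (∀ x, f x = if x ∈ s then (a x : ℂ) else 0) ∧
      ‖f‖ ^ p = ∑ x ∈ s, (ω.toFun x * |a x|) ^ p := by
  have hp0 : p ≠ 0 := by linarith [hp.out]
  have h0 : ∀ x ∉ s, (ω.toFun x * ‖(if x ∈ s then (a x : ℂ) else 0)‖) ^ p = 0 := fun x hx => by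
    simp [hx, Real.zero_rpow hp0]
  refine ⟨ofSummable _ (summable_of_ne_finset_zero h0), fun x => rfl, ?_⟩
  rw [← (hasSum_norm _).tsum_eq]
  refine (tsum_eq_sum h0).trans (Finset.sum_congr rfl fun x hx => ?_)
  simp [hx]

/-- With `f = ω^(-q)` on the ball of radius `2N` and `g = 1` on that of radius `4N`, the product `f
* g` is the constant `S = ∑ ω^(-q)` on the smaller ball. Boundedness of `m` and doubling give `S^p W
≤ const · S W`, so `S^(p-1)` is bounded independently of `N`. -/
theorem sum_latticeBall_rpow_neg_le [hp : Fact (1 < p)] (hd : 1 ≤ d) (hpq : p.HolderConjugate q)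
    {β : ℝ} (hβ : 0 ≤ β)
    {m : WeightedLp (polyWeight d β) p →L[ℂ] WeightedLp (polyWeight d β) p →L[ℂ]
      WeightedLp (polyWeight d β) p} (hm : IsConvolution m) (N : ℕ) :
    ∑ x ∈ latticeBall d (2 * N), (1 + (latticeLength x : ℝ)) ^ (-(β * q)) ≤
      (‖m‖ ^ p * (8 ^ d * 4 ^ (β * p))) ^ (1 / (p - 1)) := by
  classical
  have hp0 : 0 < p := by linarith [hp.out]
  have hp1 : 0 < p - 1 := by linarith [hp.out]
  set S := ∑ x ∈ latticeBall d (2 * N), (1 + (latticeLength x : ℝ)) ^ (-(β * q)) with hS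
  set W := ∑ x ∈ latticeBall d (2 * N), (1 + (latticeLength x : ℝ)) ^ (β * p) with hW
  have hzero : (0 : Fin d → ℤ) ∈ latticeBall d (2 * N) :=
    mem_latticeBall.2 (by simp [latticeLength])
  have hSpos : 0 < S := Finset.sum_pos (fun x _ => by positivity) ⟨0, hzero⟩
  have hWpos : 0 < W := Finset.sum_pos (fun x _ => by positivity) ⟨0, hzero⟩
  obtain ⟨f, hf, hfn⟩ := WeightedLp.exists_finset_apply (p := p) (polyWeight d β)
    (latticeBall d (2 * N)) fun x => (1 + (latticeLength x : ℝ)) ^ (-(β * q))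
  obtain ⟨g, hg, hgn⟩ := WeightedLp.exists_finset_apply (p := p) (polyWeight d β)
    (latticeBall d (4 * N)) fun _ => 1
  have hfn' : ‖f‖ ^ p = S := by
    rw [hfn]
    refine Finset.sum_congr rfl fun x _ => ?_
    rw [polyWeight_apply, abs_of_pos (by positivity), ← Real.rpow_add (by positivity),
      ← Real.rpow_mul (by positivity)]
    congr 1
    have := hpq.mul_eq_add
    -- The exponents agree because `pq = p + q`, that is `p - pq = -q`.
    linear_combination (-β) * this
  have hgn' : ‖g‖ ^ p ≤ 8 ^ d * 4 ^ (β * p) * W := by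
    rw [hgn]
    refine (Finset.sum_le_sum fun x _ => le_of_eq ?_).trans
      (sum_latticeBall_rpow_le hd (mul_nonneg hβ hp0.le) N)
    rw [polyWeight_apply, abs_one, mul_one, ← Real.rpow_mul (by positivity)]
  have hmfg : ∀ x ∈ latticeBall d (2 * N), m f g x = (S : ℂ) := fun x hx => by
    have hsupp : ∀ y ∉ latticeBall d (2 * N), f y * g (x - y) = 0 := fun y hy => by
      rw [hf, if_neg hy, zero_mul]
    rw [(hm f g x).unique (hasSum_sum_of_ne_finset_zero hsupp), hS]
    push_cast
    refine Finset.sum_congr rfl fun y hy => ?_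
    have hxy : x - y ∈ latticeBall d (4 * N) := by
      rw [mem_latticeBall] at hx hy ⊢
      have := latticeLength_add_le x (-y)
      rw [latticeLength_neg, ← sub_eq_add_neg] at this
      omega
    rw [hf, hg, if_pos hy, if_pos hxy]
    simp
  have hlow : S ^ p * W ≤ ‖m f g‖ ^ p := by
    rw [hW, Finset.mul_sum]
    refine (Finset.sum_le_sum fun x hx => le_of_eq ?_).trans
      (sum_le_hasSum (latticeBall d (2 * N))
        (fun x _ => Real.rpow_nonneg (mul_nonneg ((polyWeight d β).pos x).le (norm_nonneg _)) _)
        (WeightedLp.hasSum_norm (m f g)))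
    rw [hmfg x hx, Complex.norm_real, Real.norm_of_nonneg hSpos.le, polyWeight_apply,
      Real.mul_rpow (by positivity) hSpos.le, ← Real.rpow_mul (by positivity), mul_comm]
  have hup : ‖m f g‖ ^ p ≤ ‖m‖ ^ p * S * (8 ^ d * 4 ^ (β * p) * W) := by
    refine (Real.rpow_le_rpow (norm_nonneg _) (m.le_opNorm₂ f g) hp0.le).trans ?_
    rw [Real.mul_rpow (by positivity) (norm_nonneg _), Real.mul_rpow (norm_nonneg m)
      (norm_nonneg f), hfn']
    exact mul_le_mul_of_nonneg_left hgn' (by positivity)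
  have hfinal : S ^ (p - 1) ≤ ‖m‖ ^ p * (8 ^ d * 4 ^ (β * p)) := by
    have h1 : S ^ p = S ^ (p - 1) * S := by
      rw [← Real.rpow_add_one hSpos.ne', sub_add_cancel]
    have h2 := hlow.trans hup
    rw [h1] at h2
    refine le_of_mul_le_mul_right (a := S * W) ?_ (mul_pos hSpos hWpos)
    linarith
  have := Real.rpow_le_rpow (by positivity) hfinal (one_div_pos.2 hp1).le
  rwa [one_div, Real.rpow_rpow_inv hSpos.le hp1.ne', ← one_div] at this

theorem memℓp_one_div_polyWeight [Fact (1 < p)] (hd : 1 ≤ d) (hpq : p.HolderConjugate q)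
    {β : ℝ} (hβ : 0 ≤ β) (h : IsBanachConvAlgebra (polyWeight d β) p) :
    Memℓp (fun x => 1 / (polyWeight d β).toFun x) (ENNReal.ofReal q) := by
  obtain ⟨-, m, hm, -⟩ := h
  refine (memℓp_one_div_polyWeight_iff_summable hpq.symm.pos β).2
    (summable_of_sum_le (c := (‖m‖ ^ p * (8 ^ d * 4 ^ (β * p))) ^ (1 / (p - 1)))
      (fun x => by positivity) fun s => ?_)
  obtain ⟨N, hN⟩ := exists_subset_latticeBall s
  exact (Finset.sum_le_sum_of_subset_of_nonneg (hN (2 * N) (by omega))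
    fun _ _ _ => by positivity).trans (sum_latticeBall_rpow_neg_le hd hpq hβ hm N)

theorem isWeaklyAmenableConv_polyWeight [Fact (1 < p)] {β : ℝ} (hβ0 : 0 ≤ β) (hβ : β < 1 / 2)
    (halg : IsBanachConvAlgebra (polyWeight d β) p) : IsWeaklyAmenableConv (polyWeight d β) p := by
  refine WeightedLp.isWeaklyAmenableConv_of_tendsto halg fun x z => ?_
  -- For `n ≥ 1`, both `1 + |nx|` and `1 + |z - nx|` are at most `A n`.
  set A : ℝ := 1 + latticeLength z + latticeLength x with hA
  have hlim := ((tendsto_rpow_neg_atTop (show 0 < 1 - 2 * β by linarith)).comp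
    tendsto_natCast_atTop_atTop).const_mul (A ^ (2 * β))
  rw [mul_zero] at hlim
  refine squeeze_zero' (.of_forall fun n => div_nonneg
    (mul_nonneg ((polyWeight d β).pos _).le ((polyWeight d β).pos _).le) n.cast_nonneg) ?_ hlim
  filter_upwards [Filter.eventually_ge_atTop 1] with n hn
  have hn' : (1 : ℝ) ≤ n := by exact_mod_cast hn
  have h1 : (latticeLength (n • x) : ℝ) ≤ n * latticeLength x := by
    exact_mod_cast latticeLength_nsmul_le n x
  have h2 : (latticeLength (z - n • x) : ℝ) ≤ latticeLength z + latticeLength (n • x) := by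
    have := latticeLength_add_le z (-(n • x))
    rw [latticeLength_neg, ← sub_eq_add_neg] at this
    exact_mod_cast this
  have hz : (latticeLength z : ℝ) ≤ n * latticeLength z :=
    le_mul_of_one_le_left (Nat.cast_nonneg _) hn'
  have hz0 : (0 : ℝ) ≤ latticeLength z := Nat.cast_nonneg _
  have hA0 : 0 < A := by positivity
  have e : A ^ (2 * β) * (n : ℝ) ^ (-(1 - 2 * β)) = (A * n) ^ β * (A * n) ^ β / n := by
    rw [← Real.rpow_add (by positivity), ← two_mul, Real.mul_rpow hA0.le (by positivity),
      mul_div_assoc, ← Real.rpow_sub_one (by positivity)]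
    congr 2
    ring
  simp only [Function.comp_apply]
  rw [e]
  simp only [polyWeight_apply]
  gcongr <;> rw [hA] <;> nlinarith

/-- The `i`-th coordinate as a homomorphism `ℤ^d → ℂ`. -/
noncomputable def latticeCoordHom (i : Fin d) : (Fin d → ℤ) →+ ℂ :=
  (Int.castAddHom ℂ).comp (Pi.evalAddMonoidHom (fun _ : Fin d => ℤ) i)

theorem latticeCoordHom_apply (i : Fin d) (x : Fin d → ℤ) :
    latticeCoordHom i x = ((x i : ℤ) : ℂ) := rfl

theorem latticeCoordHom_ne_zero (i : Fin d) : latticeCoordHom i ≠ 0 := fun h => by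
  have := DFunLike.congr_fun h (fun _ => 1)
  simp [latticeCoordHom_apply] at this

theorem not_isWeaklyAmenableConv_polyWeight [Fact (1 < p)] (hd : 1 ≤ d)
    (hpq : p.HolderConjugate q) (hp2 : 2 < p) {β : ℝ} (hβ : d / q < β) :
    ¬ IsWeaklyAmenableConv (polyWeight d β) p := by
  have hp0 : 0 < p := by linarith
  have hp2' : 0 < p - 2 := by linarith
  have hd' : (1 : ℝ) ≤ d := by exact_mod_cast hd
  -- The kernel is at most `(1 + |x|)^(1-2β)`. From `βp > d(p-1)` one gets `(2β-1)p > 2d(p-1) - p ≥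
  -- d(p-2)`, the last step using `d ≥ 1`.
  have hexp : (d : ℝ) < (2 * β - 1) * (p / (p - 2)) := by
    rw [← mul_div_assoc, lt_div_iff₀ hp2']
    have h1 : (d : ℝ) / q = d * (1 - 1 / p) := by
      rw [div_eq_mul_inv, ← hpq.one_sub_inv, one_div]
    rw [h1] at hβ
    have h2 := mul_lt_mul_of_pos_right hβ hp0
    have h3 : (d : ℝ) * (1 - 1 / p) * p = d * (p - 1) := by field_simp
    rw [h3] at h2
    nlinarith
  refine WeightedLp.not_isWeaklyAmenableConv_of_summable_rpow hp2
    (latticeCoordHom ⟨0, hd⟩) (latticeCoordHom_ne_zero _)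
    ((summable_one_add_latticeLength_rpow hd hexp).of_nonneg_of_le (fun x => ?_) fun x => ?_)
  · exact Real.rpow_nonneg (div_nonneg (norm_nonneg _)
      (mul_nonneg ((polyWeight d β).pos _).le ((polyWeight d β).pos _).le)) _
  · rw [← neg_mul, Real.rpow_mul (by positivity)]
    have hle := (norm_coord_le_latticeLength x ⟨0, hd⟩).trans
      (show (latticeLength x : ℝ) ≤ 1 + latticeLength x by linarith)
    refine Real.rpow_le_rpow (div_nonneg (norm_nonneg _)
      (mul_nonneg ((polyWeight d β).pos _).le ((polyWeight d β).pos _).le)) ?_ (by positivity)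
    rw [polyWeight_apply, polyWeight_apply, latticeLength_neg, latticeCoordHom_apply,
      ← Real.rpow_add (by positivity), ← two_mul, neg_sub, Real.rpow_sub (by positivity),
      Real.rpow_one]
    gcongr

end polyWeight

/-! ### Exponential weights: general criteria and `σ`. -/

section expWeight

variable {d : ℕ} {p q : ℝ}

theorem isBanachConvAlgebra_of_eq_exp [Fact (1 < p)] (hd : 1 ≤ d) (hpq : p.HolderConjugate q)
    {ω : PosWeight (Fin d → ℤ)} {ψ : ℕ → ℝ} (hω : ∀ x, ω.toFun x = Real.exp (ψ (latticeLength x)))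
    {c a K : ℝ} (hc : 0 < c) (ha : 0 < a)
    (h : ∀ i j n : ℕ, i ≤ j → n ≤ i + j → ψ n - ψ i - ψ j ≤ K - c * (i : ℝ) ^ a) :
    IsBanachConvAlgebra ω p := by
  have hq : 0 < q := hpq.symm.pos
  refine isBanachConvAlgebra_of_latticeLength_le hpq
    ((summable_exp_neg_latticeLength_rpow hd (mul_pos hc hq) ha).mul_left (Real.exp (K * q)))
    (fun x => by positivity) fun y z hyz => ?_
  rw [hω, hω, hω, ← Real.exp_add, ← Real.exp_sub, ← Real.exp_mul]
  calc Real.exp ((ψ (latticeLength (y + z)) - (ψ (latticeLength y) + ψ (latticeLength z))) * q)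
      ≤ Real.exp (K * q + -(c * q * (latticeLength y : ℝ) ^ a)) := by
        rw [Real.exp_le_exp]
        have := mul_le_mul_of_nonneg_right (h _ _ _ hyz (latticeLength_add_le y z)) hq.le
        linarith
    _ ≤ _ := by
        rw [Real.exp_add]
        refine mul_le_mul_of_nonneg_left ?_ (Real.exp_pos _).le
        exact le_mul_of_one_le_left (Real.exp_pos _).le
          (by linarith [(latticeLength y).cast_nonneg (α := ℝ)])

theorem not_isWeaklyAmenableConv_of_eq_exp [Fact (1 < p)] (hd : 1 ≤ d)
    {ω : PosWeight (Fin d → ℤ)} {ψ : ℕ → ℝ} (hω : ∀ x, ω.toFun x = Real.exp (ψ (latticeLength x)))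
    {c a K : ℝ} (hc : 0 < c) (ha : 0 < a) (h : ∀ n : ℕ, c * (n : ℝ) ^ a - K ≤ ψ n) :
    ¬ IsWeaklyAmenableConv ω p := by
  refine WeightedLp.not_isWeaklyAmenableConv_of_summable
    (latticeCoordHom ⟨0, hd⟩) (latticeCoordHom_ne_zero _)
    (((summable_exp_neg_latticeLength_rpow hd (mul_pos two_pos hc) ha).mul_left
      (Real.exp (2 * K))).of_nonneg_of_le
        (fun x => div_nonneg (norm_nonneg _) (mul_nonneg (ω.pos _).le (ω.pos _).le)) fun x => ?_)
  rw [hω, hω, latticeLength_neg, ← Real.exp_add, div_eq_mul_inv, ← Real.exp_neg,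
    mul_left_comm, ← Real.exp_add]
  have h1 := norm_coord_le_latticeLength x ⟨0, hd⟩
  have h2 := h (latticeLength x)
  refine mul_le_mul ?_ (Real.exp_le_exp.2 (by linarith)) (Real.exp_pos _).le (by positivity)
  rw [latticeCoordHom_apply]
  linarith

/-- The points `2i` and `j` lie between `i` and `i + j` and have the same sum, so concavity gives
`i^α + (i+j)^α ≤ (2i)^α + j^α`. -/
theorem add_rpow_sub_rpow_sub_rpow_le {α : ℝ} (hα0 : 0 < α) (hα1 : α ≤ 1) {i j n : ℝ}
    (hi : 0 ≤ i) (hij : i ≤ j) (hn : 0 ≤ n) (hnij : n ≤ i + j) :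
    n ^ α - i ^ α - j ^ α ≤ -((2 - 2 ^ α) * i ^ α) := by
  have hmono := Real.rpow_le_rpow hn hnij hα0.le
  rcases hi.eq_or_lt with rfl | hi0
  · rw [Real.zero_rpow hα0.ne']
    rw [zero_add] at hmono
    linarith
  have hj0 : 0 < j := hi0.trans_le hij
  have hconc := Real.concaveOn_rpow hα0.le hα1
  have hw : i / j + (j - i) / j = 1 := by field_simp; ring
  have hw1 : 0 ≤ i / j := by positivity
  have hw2 : 0 ≤ (j - i) / j := div_nonneg (by linarith) hj0.le
  have h1 := hconc.2 (show i ∈ Set.Ici 0 from hi) (show i + j ∈ Set.Ici 0 by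
    rw [Set.mem_Ici]; linarith) hw1 hw2 hw
  have h2 := hconc.2 (show i ∈ Set.Ici 0 from hi) (show i + j ∈ Set.Ici 0 by
    rw [Set.mem_Ici]; linarith) hw2 hw1 (by rw [add_comm, hw])
  simp only [smul_eq_mul] at h1 h2
  have e1 : i / j * i + (j - i) / j * (i + j) = j := by field_simp; ring
  have e2 : (j - i) / j * i + i / j * (i + j) = 2 * i := by field_simp; ring
  rw [e1] at h1
  rw [e2, Real.mul_rpow two_pos.le hi] at h2
  have h3 : (i / j + (j - i) / j) * (i ^ α + (i + j) ^ α) = i ^ α + (i + j) ^ α := by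
    rw [hw, one_mul]
  linarith

theorem isBanachConvAlgebra_sigmaWeight [Fact (1 < p)] (hd : 1 ≤ d) (hpq : p.HolderConjugate q)
    {α C : ℝ} (hα0 : 0 < α) (hα1 : α < 1) (hC : 0 < C) :
    IsBanachConvAlgebra (sigmaWeight d α C) p := by
  have h2 : (2 : ℝ) ^ α < 2 := by
    simpa using Real.rpow_lt_rpow_of_exponent_lt (one_lt_two (α := ℝ)) hα1
  refine isBanachConvAlgebra_of_eq_exp hd hpq (ψ := fun n => C * (n : ℝ) ^ α) (fun x => rfl)
    (c := C * (2 - 2 ^ α)) (a := α) (K := 0) (mul_pos hC (by linarith)) hα0 fun i j n hij hn => ?_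
  have := add_rpow_sub_rpow_sub_rpow_le hα0 hα1.le (i := i) (j := j) (n := n) (Nat.cast_nonneg _)
    (by exact_mod_cast hij) (Nat.cast_nonneg _) (by exact_mod_cast hn)
  have := mul_le_mul_of_nonneg_left this hC.le
  linarith

theorem not_isWeaklyAmenableConv_sigmaWeight [Fact (1 < p)] (hd : 1 ≤ d) {α C : ℝ} (hα : 0 < α)
    (hC : 0 < C) : ¬ IsWeaklyAmenableConv (sigmaWeight d α C) p :=
  not_isWeaklyAmenableConv_of_eq_exp hd (ψ := fun n => C * (n : ℝ) ^ α) (fun x => rfl)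
    (K := 0) hC hα fun n => by simp

/-! ### The weight `ρ`. -/

/-- The function `n / (log (1 + n))^γ` in the exponent of `rhoWeight`. -/
noncomputable def divLogRpow (γ : ℝ) (n : ℕ) : ℝ := n / Real.log (1 + n) ^ γ

theorem log_one_add_pos {n : ℕ} (hn : 1 ≤ n) : 0 < Real.log (1 + n) :=
  Real.log_pos (by have : (1 : ℝ) ≤ n := by exact_mod_cast hn
                   linarith)

theorem divLogRpow_zero (γ : ℝ) : divLogRpow γ 0 = 0 := by simp [divLogRpow]

theorem divLogRpow_nonneg (γ : ℝ) (n : ℕ) : 0 ≤ divLogRpow γ n :=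
  div_nonneg n.cast_nonneg (Real.rpow_nonneg (Real.log_nonneg (by simp)) _)

/-- The function increases only once `log(1+m) ≥ γ`. Smaller `m` satisfy `m < e^γ`, and the additive
constant bounds the function there. -/
theorem divLogRpow_le_add {γ : ℝ} (hγ : 0 < γ) {m n : ℕ} (hmn : m ≤ n) :
    divLogRpow γ m ≤ divLogRpow γ n + Real.exp γ / Real.log 2 ^ γ := by
  have hlog2 : 0 < Real.log 2 := Real.log_pos one_lt_two
  have hK : 0 ≤ Real.exp γ / Real.log 2 ^ γ := by positivity
  rcases Nat.eq_zero_or_pos m with rfl | hm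
  · rw [divLogRpow_zero]
    exact add_nonneg (divLogRpow_nonneg _ _) hK
  have hm' : (1 : ℝ) ≤ m := by exact_mod_cast hm
  have hmn' : (m : ℝ) ≤ n := by exact_mod_cast hmn
  have hLm := log_one_add_pos hm
  have hLn := log_one_add_pos (hm.trans_le hmn)
  rcases lt_or_ge (Real.log (1 + m)) γ with hlt | hge
  · refine le_add_of_nonneg_of_le (divLogRpow_nonneg _ _) ?_
    refine div_le_div₀ (Real.exp_pos _).le ?_ (by positivity) ?_
    · have := (Real.log_lt_iff_lt_exp (by positivity)).1 hlt
      linarith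
    · exact Real.rpow_le_rpow hlog2.le (Real.log_le_log two_pos (by linarith)) hγ.le
  · refine le_add_of_le_of_nonneg ?_ hK
    rw [divLogRpow, divLogRpow, div_le_div_iff₀ (by positivity) (by positivity),
      ← div_le_iff₀ (by positivity), mul_div_assoc, ← Real.div_rpow hLn.le hLm.le,
      mul_comm, ← le_div_iff₀ (by positivity)]
    have hdiff : 0 ≤ Real.log (1 + n) - Real.log (1 + m) :=
      sub_nonneg.2 (Real.log_le_log (by positivity) (by linarith))
    calc (Real.log (1 + n) / Real.log (1 + m)) ^ γ
        = Real.exp (Real.log (Real.log (1 + n) / Real.log (1 + m)) * γ) :=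
          Real.rpow_def_of_pos (div_pos hLn hLm) _
      _ ≤ Real.exp (Real.log (1 + n) - Real.log (1 + m)) := by
          rw [Real.exp_le_exp]
          have h1 := Real.log_le_sub_one_of_pos (div_pos hLn hLm)
          have h2 : Real.log (1 + n) / Real.log (1 + m) - 1 =
            (Real.log (1 + n) - Real.log (1 + m)) / Real.log (1 + m) := by field_simp
          rw [h2] at h1
          refine (mul_le_mul_of_nonneg_right h1 hγ.le).trans ?_
          rw [div_mul_eq_mul_div, div_le_iff₀ hLm]
          exact mul_le_mul_of_nonneg_left hge hdiff
      _ = (1 + n) / (1 + m) := by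
          rw [Real.exp_sub, Real.exp_log (by positivity), Real.exp_log (by positivity)]
      _ ≤ n / m := by
          rw [div_le_div_iff₀ (by positivity) (by positivity)]
          linarith

/-- Quantifies the loss when `log(1+i)` is replaced by `log(1+2i)`: the two differ by at least
`log(3/2)`, and `r^γ ≥ 1 + γ log r ≥ 1 + γ(1 - 1/r)` for their ratio `r`. -/
theorem div_log_two_mul_rpow_le {γ : ℝ} (hγ : 0 < γ) {i : ℕ} (hi : 1 ≤ i) :
    (i : ℝ) / Real.log (1 + (2 * i : ℕ)) ^ γ +
      γ * Real.log (3 / 2) * (i / Real.log (1 + (2 * i : ℕ)) ^ (γ + 1)) ≤ divLogRpow γ i := by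
  have hi' : (1 : ℝ) ≤ i := by exact_mod_cast hi
  have hL := log_one_add_pos hi
  have hL2 := log_one_add_pos (show 1 ≤ 2 * i by omega)
  set L := Real.log (1 + i)
  set L2 := Real.log (1 + (2 * i : ℕ)) with hL2_def
  have hdiff : Real.log (3 / 2) ≤ L2 - L := by
    rw [hL2_def, ← Real.log_div (by positivity) (by positivity)]
    refine Real.log_le_log (by norm_num) ?_
    rw [div_le_div_iff₀ (by norm_num) (by positivity)]
    push_cast
    linarith
  have hr : 0 < L2 / L := div_pos hL2 hL
  have hpow : 1 + γ * Real.log (3 / 2) / L2 ≤ (L2 / L) ^ γ := by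
    rw [Real.rpow_def_of_pos hr]
    have h1 := Real.one_sub_inv_le_log_of_pos hr
    have h2 : 1 - (L2 / L)⁻¹ = (L2 - L) / L2 := by field_simp
    rw [h2] at h1
    have h3 : Real.log (3 / 2) / L2 ≤ (L2 - L) / L2 := by gcongr
    have h4 := mul_le_mul_of_nonneg_right (h3.trans h1) hγ.le
    have h5 := Real.add_one_le_exp (Real.log (L2 / L) * γ)
    have h6 : γ * Real.log (3 / 2) / L2 = Real.log (3 / 2) / L2 * γ := by ring
    linarith
  have key := mul_le_mul_of_nonneg_left hpow (show 0 ≤ (i : ℝ) / L2 ^ γ by positivity)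
  have e1 : (i : ℝ) / L2 ^ γ * (L2 / L) ^ γ = divLogRpow γ i := by
    rw [Real.div_rpow hL2.le hL.le, show divLogRpow γ i = i / L ^ γ from rfl]
    field_simp
  rw [e1] at key
  refine le_trans (le_of_eq ?_) key
  rw [Real.rpow_add_one hL2.ne']
  field_simp

theorem exists_mul_rpow_half_le_div_log {γ : ℝ} (hγ : 0 < γ) :
    ∃ c : ℝ, 0 < c ∧ ∀ i : ℕ, 1 ≤ i →
      c * (i : ℝ) ^ (1 / 2 : ℝ) ≤ i / Real.log (1 + (2 * i : ℕ)) ^ (γ + 1) := by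
  -- Chosen so that `log t ≤ t^ε / ε`, raised to the power `γ + 1`, costs exactly `t^(1/2)`.
  set ε : ℝ := 1 / (2 * (γ + 1)) with hε
  have hε0 : 0 < ε := by positivity
  refine ⟨ε ^ (γ + 1) / 3 ^ (1 / 2 : ℝ), by positivity, fun i hi => ?_⟩
  have hi' : (1 : ℝ) ≤ i := by exact_mod_cast hi
  have hL2 := log_one_add_pos (show 1 ≤ 2 * i by omega)
  have h1 : Real.log (1 + (2 * i : ℕ)) ^ (γ + 1) ≤
      3 ^ (1 / 2 : ℝ) * (i : ℝ) ^ (1 / 2 : ℝ) / ε ^ (γ + 1) := by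
    have h2 := Real.rpow_le_rpow hL2.le
      (Real.log_le_rpow_div (show (0 : ℝ) ≤ 1 + (2 * i : ℕ) by positivity) hε0)
      (show 0 ≤ γ + 1 by linarith)
    rw [Real.div_rpow (by positivity) hε0.le, ← Real.rpow_mul (by positivity),
      show ε * (γ + 1) = 1 / 2 by rw [hε]; field_simp] at h2
    refine h2.trans ?_
    rw [← Real.mul_rpow (by norm_num) (by positivity)]
    gcongr
    push_cast
    linarith
  rw [le_div_iff₀ (by positivity)]
  refine (mul_le_mul_of_nonneg_left h1 (by positivity)).trans (le_of_eq ?_)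
  have h3 : (i : ℝ) ^ (1 / 2 : ℝ) * (i : ℝ) ^ (1 / 2 : ℝ) = i := by
    rw [← Real.rpow_add (by positivity)]
    norm_num
  have h4 : ε ^ (γ + 1) ≠ 0 := by positivity
  have h5 : (3 : ℝ) ^ (1 / 2 : ℝ) ≠ 0 := by positivity
  calc _ = (i : ℝ) ^ (1 / 2 : ℝ) * (i : ℝ) ^ (1 / 2 : ℝ) := by field_simp
    _ = i := h3

/-- Split `(i+j) / log^γ(1+i+j)` into its `i` and `j` parts. The `j` part is at most the value at
`j`; in the `i` part `i + j ≥ 2i` makes the logarithm larger, and this gain beats a multiple of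
`i^(1/2)`. -/
theorem exists_divLogRpow_sub_le {γ : ℝ} (hγ : 0 < γ) :
    ∃ c K : ℝ, 0 < c ∧ ∀ i j n : ℕ, i ≤ j → n ≤ i + j →
      divLogRpow γ n - divLogRpow γ i - divLogRpow γ j ≤ K - c * (i : ℝ) ^ (1 / 2 : ℝ) := by
  obtain ⟨c, hc, h⟩ := exists_mul_rpow_half_le_div_log hγ
  have hlog : 0 < γ * Real.log (3 / 2) := mul_pos hγ (Real.log_pos (by norm_num))
  refine ⟨γ * Real.log (3 / 2) * c, Real.exp γ / Real.log 2 ^ γ, mul_pos hlog hc,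
    fun i j n hij hn => ?_⟩
  have hmono := divLogRpow_le_add hγ hn
  rcases Nat.eq_zero_or_pos i with rfl | hi
  · rw [zero_add] at hmono
    rw [divLogRpow_zero, Nat.cast_zero, Real.zero_rpow (by norm_num)]
    linarith
  have h1 := div_log_two_mul_rpow_le hγ hi
  have h2 := mul_le_mul_of_nonneg_left (h i hi) hlog.le
  have hLj := log_one_add_pos (hi.trans_le hij)
  have hL2 := log_one_add_pos (show 1 ≤ 2 * i by omega)
  have hsum : divLogRpow γ (i + j) ≤ i / Real.log (1 + (2 * i : ℕ)) ^ γ + divLogRpow γ j := by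
    have hij' : ((2 * i : ℕ) : ℝ) ≤ (i + j : ℕ) := by exact_mod_cast (by omega : 2 * i ≤ i + j)
    have hj' : (j : ℝ) ≤ (i + j : ℕ) := by exact_mod_cast (by omega : j ≤ i + j)
    have e : divLogRpow γ (i + j) =
        i / Real.log (1 + (i + j : ℕ)) ^ γ + j / Real.log (1 + (i + j : ℕ)) ^ γ := by
      rw [divLogRpow, ← add_div]
      push_cast
      rfl
    rw [e, divLogRpow]
    gcongr
  linarith

theorem rhoWeight_apply (γ C : ℝ) (x : Fin d → ℤ) :
    (rhoWeight d γ C).toFun x = Real.exp (C * divLogRpow γ (latticeLength x)) := by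
  rw [divLogRpow, ← mul_div_assoc]
  rfl

theorem isBanachConvAlgebra_rhoWeight [Fact (1 < p)] (hd : 1 ≤ d) (hpq : p.HolderConjugate q)
    {γ C : ℝ} (hγ : 0 < γ) (hC : 0 < C) : IsBanachConvAlgebra (rhoWeight d γ C) p := by
  obtain ⟨c, K, hc, h⟩ := exists_divLogRpow_sub_le hγ
  refine isBanachConvAlgebra_of_eq_exp hd hpq (ψ := fun n => C * divLogRpow γ n)
    (rhoWeight_apply γ C) (c := C * c) (a := 1 / 2) (K := C * K) (mul_pos hC hc) (by norm_num)
    fun i j n hij hn => ?_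
  have := mul_le_mul_of_nonneg_left (h i j n hij hn) hC.le
  linarith

theorem not_isWeaklyAmenableConv_rhoWeight [Fact (1 < p)] (hd : 1 ≤ d)
    {γ C : ℝ} (hγ : 0 < γ) (hC : 0 < C) : ¬ IsWeaklyAmenableConv (rhoWeight d γ C) p := by
  obtain ⟨c, K, hc, h⟩ := exists_divLogRpow_sub_le hγ
  refine not_isWeaklyAmenableConv_of_eq_exp hd (ψ := fun n => C * divLogRpow γ n)
    (rhoWeight_apply γ C) (c := C * c / 2) (a := 1 / 2) (K := C * K / 2) (by positivity)
    (by norm_num) fun n => ?_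
  -- Taking `i = j = n` and total `0` turns the algebra inequality into a lower bound for the
  -- exponent itself.
  have h1 := h n n 0 le_rfl (Nat.zero_le _)
  rw [divLogRpow_zero] at h1
  have := mul_le_mul_of_nonneg_left h1 hC.le
  linarith

end expWeight

theorem mainTheorem6 (d : ℕ) (hd : 1 ≤ d) (p q : ℝ) [Fact (1 < p)] (hpq : p.HolderConjugate q) :
    (∀ β : ℝ, 0 ≤ β →
      (IsBanachConvAlgebra (polyWeight d β) p ↔
        Memℓp (fun x => 1 / (polyWeight d β).toFun x) (ENNReal.ofReal q)) ∧
      (IsBanachConvAlgebra (polyWeight d β) p ↔ (d : ℝ) / q < β)) ∧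
    (p < 2 → ∀ β : ℝ, (d : ℝ) / q < β → β < 1 / 2 → IsWeaklyAmenableConv (polyWeight d β) p) ∧
    (2 < p → ∀ β : ℝ, (d : ℝ) / q < β → ¬ IsWeaklyAmenableConv (polyWeight d β) p) ∧
    (∀ α C : ℝ, 0 < α → α < 1 → 0 < C → IsBanachConvAlgebra (sigmaWeight d α C) p) ∧
    (∀ α C : ℝ, 0 < α → α ≤ 1 → 0 < C → IsBanachConvAlgebra (sigmaWeight d α C) p →
      ¬ IsWeaklyAmenableConv (sigmaWeight d α C) p) ∧
    (∀ γ C : ℝ, 0 < γ → 0 < C →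
      IsBanachConvAlgebra (rhoWeight d γ C) p ∧ ¬ IsWeaklyAmenableConv (rhoWeight d γ C) p) := by
  have hq : 0 < q := hpq.symm.pos
  have halg : ∀ β : ℝ, 0 ≤ β → (IsBanachConvAlgebra (polyWeight d β) p ↔
      Memℓp (fun x => 1 / (polyWeight d β).toFun x) (ENNReal.ofReal q)) := fun β hβ =>
    ⟨memℓp_one_div_polyWeight hd hpq hβ, isBanachConvAlgebra_polyWeight hpq hβ⟩
  have halg' : ∀ β : ℝ, 0 ≤ β → (IsBanachConvAlgebra (polyWeight d β) p ↔ (d : ℝ) / q < β) :=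
    fun β hβ => (halg β hβ).trans (memℓp_one_div_polyWeight_iff_lt hd hq hβ)
  refine ⟨fun β hβ => ⟨halg β hβ, halg' β hβ⟩, fun _ β hβ hβ2 => ?_,
    fun hp2 β hβ => not_isWeaklyAmenableConv_polyWeight hd hpq hp2 hβ,
    fun α C hα0 hα1 hC => isBanachConvAlgebra_sigmaWeight hd hpq hα0 hα1 hC,
    fun α C hα0 _ hC _ => not_isWeaklyAmenableConv_sigmaWeight hd hα0 hC,
    fun γ C hγ hC => ⟨isBanachConvAlgebra_rhoWeight hd hpq hγ hC,
      not_isWeaklyAmenableConv_rhoWeight hd hγ hC⟩⟩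
  have hβ0 : 0 ≤ β := (div_nonneg d.cast_nonneg hq.le).trans hβ.le
  exact isWeaklyAmenableConv_polyWeight hβ0 hβ2 ((halg' β hβ0).2 hβ)
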